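/- Let $\mu,\nu$ be probability measures on $\mathbb Z$. Let $(S_n)$ be the oscillating random walk on $\mathbb Z$: the Markov chain whose jump from $x$ has law $\mu$ if $x\le 0$ and law $\nu$ if $x\ge 1$. For $k\ge 1$, let $\mu_+(k)$ be the probability that the random walk with i.i.d. steps of law $\mu$, started at $0$, enters $\{1,2,\dots\}$ at $k$, and let $\nu_-(-k)$ be the probability that the random walk with i.i.d. steps of law $\nu$, started at $0$, enters $\{-1,-2,\dots\}$ at $-k$. Assume that $\mu_+$ and $\nu_-$ are probability measures, and let $(Z_n)$ be the Markov chain on $\mathbb Z$ whose jump from $x$ has law $\mu_+$ if $x\le 0$ and law $\nu_-$ if $x\ge 1$. Assume that $(Z_n)$ is irreducible on $\mathbb Z$. Write $\hat{\mu}_+(t)=\sum_{k}e^{itk}\mu_+(k)$ and $\hat{\nu}_-(t)=\sum_k e^{itk}\nu_-(k)$. (i) The measure $\pi(y)=\mu_+([y,\infty))1_{y\ge 1}+\nu_-((-\infty,y-1])1_{y\le 0}$ on $\mathbb Z$ is invariant for $(Z_n)$, and $(Z_n)$ is positive recurrent if and only if both $\mu_+$ and $\nu_-$ have finite mean. (ii)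 If exactly one of $\mu_+$, $\nu_-$ has finite mean, then $(Z_n)$ is null recurrent. (iii) If $\int_0^{2\pi}|1-\hat{\mu}_+(t)|^{-2}\,dt<\infty$ and $\int_0^{2\pi}|1-\hat{\nu}_-(t)|^{-2}\,dt<\infty$, then $(Z_n)$ is transient, and $(S_n)$ is transient as well. -/

import Mathlib

open MeasureTheory ProbabilityTheory
open scoped ENNReal

noncomputable section

namespace OscWalk

/-! ### Markov chains on `ℤ` and their classification -/

/-- The law `P_x` on trajectories `ℕ → ℤ` of the time-homogeneous Markov chain with transition
kernel `p` started at `x` (given by the Ionescu-Tulcea theorem; given the past up to time `n`,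
the state at time `n + 1` has law `p` evaluated at the state at time `n`). -/
def pathLaw (p : Kernel ℤ ℤ) [IsMarkovKernel p] (x : ℤ) : Measure (ℕ → ℤ) :=
  Kernel.traj (X := fun _ => ℤ)
    (fun n => p.comap (fun h : (i : Finset.Iic n) → ℤ => h ⟨n, Finset.mem_Iic.2 le_rfl⟩)
      (measurable_pi_apply _))
    0 (fun _ => x)

/-- `T_y = min {n ≥ 1 | S_n = y}`, equal to `⊤` if there is no such `n`. -/
def passageTime (y : ℤ) (ω : ℕ → ℤ) : ℕ∞ :=
  ⨅ (n : ℕ) (_ : 1 ≤ n ∧ ω n = y), (n : ℕ∞)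

/-- Every state can be reached from every state with positive probability. -/
def IsIrreducible (p : Kernel ℤ ℤ) [IsMarkovKernel p] : Prop :=
  ∀ x y : ℤ, ∃ n : ℕ, 0 < pathLaw p x {ω | ω n = y}

/-- Every state `x` is transient: `P_x(T_x < ∞) < 1`. -/
def IsTransient (p : Kernel ℤ ℤ) [IsMarkovKernel p] : Prop :=
  ∀ x : ℤ, pathLaw p x {ω | passageTime x ω < ⊤} < 1

/-- Every state `x` is positive recurrent: `P_x(T_x < ∞) = 1` and `E_x(T_x) < ∞`. -/
def IsPositiveRecurrent (p : Kernel ℤ ℤ) [IsMarkovKernel p] : Prop :=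
  ∀ x : ℤ, pathLaw p x {ω | passageTime x ω < ⊤} = 1 ∧
    ∫⁻ ω, (passageTime x ω : ℝ≥0∞) ∂(pathLaw p x) < ⊤

/-- Every state `x` is null recurrent: `P_x(T_x < ∞) = 1` and `E_x(T_x) = ∞`. -/
def IsNullRecurrent (p : Kernel ℤ ℤ) [IsMarkovKernel p] : Prop :=
  ∀ x : ℤ, pathLaw p x {ω | passageTime x ω < ⊤} = 1 ∧
    ∫⁻ ω, (passageTime x ω : ℝ≥0∞) ∂(pathLaw p x) = ⊤

/-! ### Homogeneous and oscillating random walks -/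

/-- Transition kernel of the random walk on `ℤ` whose jump from `x` has law `σ x`. -/
def walkKernel (σ : ℤ → Measure ℤ) : Kernel ℤ ℤ where
  toFun x := (σ x).map (fun k => x + k)
  measurable' := Measurable.of_discrete

instance (σ : ℤ → Measure ℤ) [∀ x, IsProbabilityMeasure (σ x)] :
    IsMarkovKernel (walkKernel σ) :=
  ⟨fun _ => Measure.isProbabilityMeasure_map Measurable.of_discrete.aemeasurable⟩

/-- The jump laws of the oscillating walk: `μ` on `(-∞, 0]`, `ν` on `[1, ∞)`. -/
def oscStep (μ ν : Measure ℤ) (x : ℤ) : Measure ℤ := if x ≤ 0 then μ else ν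

instance (μ ν : Measure ℤ) [IsProbabilityMeasure μ] [IsProbabilityMeasure ν] (x : ℤ) :
    IsProbabilityMeasure (oscStep μ ν x) := by
  unfold oscStep; split <;> infer_instance

/-- Transition kernel of the homogeneous random walk with step law `μ`. -/
abbrev homWalk (μ : Measure ℤ) : Kernel ℤ ℤ := walkKernel fun _ => μ

/-- Transition kernel of the oscillating random walk associated with `μ` and `ν`. -/
abbrev oscWalk (μ ν : Measure ℤ) : Kernel ℤ ℤ := walkKernel (oscStep μ ν)

/-- The (possibly defective) law of the point at which the homogeneous random walk with step
law `μ`, started at `0`, enters `B`; used below for sets `B` that do not contain `0`. -/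
def entranceLaw (μ : Measure ℤ) [IsProbabilityMeasure μ] (B : Set ℤ) : Measure ℤ :=
  Measure.sum fun k : ℤ =>
    pathLaw (homWalk μ) 0 {ω | ∃ n : ℕ, ω n = k ∧ k ∈ B ∧ ∀ m < n, ω m ∉ B} • Measure.dirac k

/-- `μ_+(k) = P_0^μ(S_n enters {1, 2, …} at k)`. -/
abbrev muPlus (μ : Measure ℤ) [IsProbabilityMeasure μ] : Measure ℤ := entranceLaw μ (Set.Ici 1)

/-- `ν_-(-k) = P_0^ν(S_n enters {-1, -2, …} at -k)`. -/
abbrev nuMinus (ν : Measure ℤ) [IsProbabilityMeasure ν] : Measure ℤ :=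
  entranceLaw ν (Set.Iic (-1))

/-- Characteristic function `t ↦ E(e^{itX})` of a law on `ℤ`. -/
def charFn (μ : Measure ℤ) (t : ℝ) : ℂ := ∫ k : ℤ, Complex.exp (Complex.I * t * k) ∂μ

/-- The measure `π(y) = α(≥ y) 1_{y ≥ 1} + β(≤ y - 1) 1_{y ≤ 0}` on `ℤ`. -/
def piMeasure (α β : Measure ℤ) : Measure ℤ :=
  Measure.count.withDensity fun y =>
    if 1 ≤ y then α (Set.Ici y) else β (Set.Iic (y - 1))

end OscWalk

end

/-!
The statement is reduced to computations with nonnegative infinite matrices acting as operators on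
`[0, ∞]`-valued functions: `op a f x = ∑ z, a x z * f z`, and `taboo a B` suppresses the transitions
into `B`. By the Markov property (`lintegral_avoid`), the probability `P_x(T_y > n)` equals
`(op (taboo p {y}) ^ n) 1 x`, so that recurrence, transience and `E_x(T_x)` are read off these
powers. A state is transient if and only if its Green function `∑ n, p^n(x, x)` is finite
(`iInf_survive_ne_zero_of_green_lt_top`, `green_lt_top_of_iInf_survive_ne_zero`), and for an
irreducible chain all states behave alike (`green_lt_top_of_communicate`).

Invariance of `π` is a double-sum identity (`piWeight_invariant`). The masses `π([1, ∞))` and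
`π((-∞, 0])` are the absolute means of `μ_+` and `ν_-`, and both half-lines are surely visited again
and again, because the chain `Z` climbs on `(-∞, 0]` and descends on `[1, ∞)`. One finite mean thus
gives recurrence: the chain induced on the half-line of finite mass preserves a finite measure
(`green_eq_top_of_finite_recurrent_set`). Kac's formula `π(ℤ) = π(x) E_x(T_x)`
(`tsum_eq_mul_tsum_survive`) then separates positive from null recurrence.

For the transience of `Z`, every trajectory is a shuffle of steps of law `μ_+` and steps of law
`ν_-`, whence `∑ n, p^n(0, 0) ≤ ∑ i j, (μ_+^{*i} * ν_-^{*j})(0)` (`op_oscWalk_pow_le`). By Fourier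
inversion the partial sums of the right-hand side are integrals of products of two geometric sums,
bounded by `4 / (|1 - φ| |1 - ψ|) ≤ 4 (|1 - φ|⁻² + |1 - ψ|⁻²)` with `φ`, `ψ` the two characteristic
functions (`green_oscWalk_zero_lt_top`).

Finally `Z` is the oscillating walk `S` observed whenever it passes strictly
beyond its last observed position, upwards from `(-∞, 0]` and downwards from `[1, ∞)`.
Between two observations `S` visits each state finitely often in the mean, which bounds the Green
function of `S` by that of `Z` (`green_oscWalk_lt_top`).
-/

noncomputable section

namespace OscWalk

/-! ### Nonnegative matrices and their Green functions -/

section Potential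

variable {ι : Type*}

/-- The operator `f ↦ (x ↦ ∑ z, a x z * f z)` on `[0, ∞]`-valued functions associated with a
nonnegative matrix `a`. Sums of `[0, ∞]`-valued families commute, so that no summability condition
is needed and powers of `op a` are the powers of the infinite matrix `a`. -/
def op (a : ι → ι → ℝ≥0∞) : Module.End ℝ≥0∞ (ι → ℝ≥0∞) where
  toFun f x := ∑' z, a x z * f z
  map_add' f g := by
    ext x; simp [mul_add, ENNReal.tsum_add]
  map_smul' c f := by
    ext x; simp [← ENNReal.tsum_mul_left, mul_left_comm]

/-- The matrix `a` with the transitions into `B` suppressed. -/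
def taboo (a : ι → ι → ℝ≥0∞) (B : Set ι) (x : ι) : ι → ℝ≥0∞ := Bᶜ.indicator (a x)

/-- The operator of the matrix `a` stopped at its first entrance into `B` at a positive time:
`hitOp a B f x` is the expectation of `f` at the entrance point. -/
def hitOp (a : ι → ι → ℝ≥0∞) (B : Set ι) (f : ι → ℝ≥0∞) (x : ι) : ℝ≥0∞ :=
  ∑' n : ℕ, (op (taboo a B) ^ n) (op (taboo a Bᶜ) f) x

variable {a : ι → ι → ℝ≥0∞} {B : Set ι} {f g : ι → ℝ≥0∞} {x y z : ι}

lemma op_apply : op a f x = ∑' z, a x z * f z := rfl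

lemma op_mono (h : f ≤ g) : op a f ≤ op a g := fun x =>
  ENNReal.tsum_le_tsum fun z => mul_le_mul_right (h z) (a x z)

lemma op_pow_mono (h : f ≤ g) (n : ℕ) : (op a ^ n) f ≤ (op a ^ n) g := by
  induction n with
  | zero => simpa
  | succ n ih => rw [pow_succ', Module.End.mul_apply, Module.End.mul_apply]; exact op_mono ih

lemma op_tsum {κ : Type*} (F : κ → ι → ℝ≥0∞) :
    op a (fun z => ∑' k, F k z) x = ∑' k, op a (F k) x := by
  simp only [op_apply, ← ENNReal.tsum_mul_left]
  exact ENNReal.tsum_comm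

lemma op_pow_succ_apply (n : ℕ) : (op a ^ (n + 1)) f = op a ((op a ^ n) f) := by
  rw [pow_succ', Module.End.mul_apply]

lemma op_pow_succ_apply' (n : ℕ) : (op a ^ (n + 1)) f = (op a ^ n) (op a f) := by
  rw [pow_succ, Module.End.mul_apply]

lemma op_taboo_add (a : ι → ι → ℝ≥0∞) (B : Set ι) :
    op a = op (taboo a B) + op (taboo a Bᶜ) := by
  ext f x
  simp only [LinearMap.add_apply, Pi.add_apply, op_apply, ← ENNReal.tsum_add, taboo, ← add_mul,
    compl_compl]
  exact tsum_congr fun z => by rw [← Pi.add_apply, Set.indicator_compl_add_self]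

lemma op_eq_taboo_add (a : ι → ι → ℝ≥0∞) (B : Set ι) (f : ι → ℝ≥0∞) :
    op a f = op (taboo a B) f + op (taboo a Bᶜ) f := by
  conv_lhs => rw [op_taboo_add a B]
  rfl

lemma op_taboo_congr (h : ∀ z ∉ B, f z = g z) : op (taboo a B) f = op (taboo a B) g := by
  ext x
  refine tsum_congr fun z => ?_
  by_cases hz : z ∈ B
  · simp [taboo, hz]
  · rw [h z hz]

lemma op_one_le (ha : ∀ x, ∑' z, a x z ≤ 1) : op a 1 ≤ 1 := fun x => by
  simpa [op_apply] using ha x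

lemma op_one (ha : ∀ x, ∑' z, a x z = 1) : op a 1 = 1 := by
  ext x; simpa [op_apply] using ha x

lemma taboo_tsum_le (ha : ∀ x, ∑' z, a x z ≤ 1) (x : ι) : ∑' z, taboo a B x z ≤ 1 :=
  (ENNReal.tsum_le_tsum fun _ => Set.indicator_le_self _ _ _).trans (ha x)

lemma op_pow_one_antitone (ha : ∀ x, ∑' z, a x z ≤ 1) (x : ι) :
    Antitone fun n => (op a ^ n) 1 x := by
  refine antitone_nat_of_succ_le fun n => ?_
  rw [op_pow_succ_apply']
  exact op_pow_mono (op_one_le ha) n x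

lemma op_pow_one_le (ha : ∀ x, ∑' z, a x z ≤ 1) (x : ι) (n : ℕ) : (op a ^ n) 1 x ≤ 1 := by
  simpa using op_pow_one_antitone ha x (Nat.zero_le n)

/-- First entrance decomposition of the constant function `1` under a stochastic matrix. -/
lemma sum_hit_add_survive (ha : ∀ x, ∑' z, a x z = 1) (N : ℕ) :
    ∑ n ∈ Finset.range N, (op (taboo a B) ^ n) (op (taboo a Bᶜ) 1) + (op (taboo a B) ^ N) 1
      = 1 := by
  induction N with
  | zero => simp
  | succ N ih =>
    rw [Finset.sum_range_succ, op_pow_succ_apply', add_assoc, ← map_add, add_comm (op _ 1),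
      ← LinearMap.add_apply, ← op_taboo_add, op_one ha, ih]

/-- First-step decomposition of the hitting operator. -/
lemma hitOp_eq (f : ι → ℝ≥0∞) :
    hitOp a B f x = op (taboo a Bᶜ) f x + op (taboo a B) (hitOp a B f) x := by
  unfold hitOp
  rw [op_tsum, tsum_eq_zero_add' ENNReal.summable]
  simp [op_pow_succ_apply]

/-- A stochastic chain either enters `B` at a positive time or avoids it forever. -/
lemma hitOp_one_add_iInf (ha : ∀ x, ∑' z, a x z = 1) (x : ι) :
    hitOp a B 1 x + ⨅ n, (op (taboo a B) ^ n) 1 x = 1 := by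
  have h1 : Filter.Tendsto (fun N => ∑ n ∈ Finset.range N,
      (op (taboo a B) ^ n) (op (taboo a Bᶜ) 1) x) Filter.atTop (nhds (hitOp a B 1 x)) :=
    ENNReal.tendsto_nat_tsum _
  have h2 := tendsto_atTop_iInf
    (op_pow_one_antitone (taboo_tsum_le (B := B) (fun x => (ha x).le)) x)
  have h3 := h1.add h2
  refine tendsto_nhds_unique h3 (tendsto_const_nhds.congr fun N => ?_)
  have := congrFun (sum_hit_add_survive (B := B) ha N) x
  simpa using this.symm

/-- First entrance decomposition of the truncated Green operator: at most `N` further steps are left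
after the entrance into `B`. -/
lemma sum_op_pow_succ_le (a : ι → ι → ℝ≥0∞) (B : Set ι) (f : ι → ℝ≥0∞) (N : ℕ) (x : ι) :
    ∑ n ∈ Finset.range (N + 1), (op a ^ n) f x ≤
      ∑' n, (op (taboo a B) ^ n) f x + hitOp a B (∑ n ∈ Finset.range N, (op a ^ n) f) x := by
  induction N generalizing x with
  | zero => 
    have h := ENNReal.le_tsum (f := fun n => (op (taboo a B) ^ n) f x) 0
    simpa using le_add_right h
  | succ N ih =>
    have hmono : hitOp a B (∑ n ∈ Finset.range N, (op a ^ n) f) ≤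
        hitOp a B (∑ n ∈ Finset.range (N + 1), (op a ^ n) f) := fun z =>
      ENNReal.tsum_le_tsum fun n => op_pow_mono (op_mono
        (Finset.sum_le_sum_of_subset (Finset.range_mono (Nat.le_succ N)))) n z
    have ih' : ∑ n ∈ Finset.range (N + 1), (op a ^ n) f ≤
        (fun z => ∑' n, (op (taboo a B) ^ n) f z) +
          hitOp a B (∑ n ∈ Finset.range (N + 1), (op a ^ n) f) := fun z => by
      simpa using (ih z).trans (add_le_add_right (hmono z) _)
    rw [Finset.sum_range_succ', hitOp_eq, tsum_eq_zero_add' ENNReal.summable]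
    simp only [op_pow_succ_apply, pow_zero, Module.End.one_apply]
    rw [← Finset.sum_apply, ← map_sum, op_taboo_add a B, LinearMap.add_apply, Pi.add_apply]
    have h1 := op_mono (a := taboo a B) ih' x
    rw [map_add, Pi.add_apply, op_tsum] at h1
    rw [← op_taboo_add]
    calc _ ≤ _ := add_le_add_left (add_le_add_left h1 _) _
      _ = _ := by ring

variable [DecidableEq ι]

/-- The Green function of `a`: `green a y x` is the expected number of visits to `y`
starting from `x`. The target comes first, so that `op a` acts on the function `green a y`. -/
def green (a : ι → ι → ℝ≥0∞) (y x : ι) : ℝ≥0∞ := ∑' n : ℕ, (op a ^ n) (Pi.single y 1) x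

lemma op_single : op a (Pi.single y 1) x = a x y := by
  rw [op_apply, tsum_eq_single y]
  · simp
  · intro z hz; simp [hz]

lemma eq_tsum_single (f : ι → ℝ≥0∞) : f = fun x => ∑' z, f z * (Pi.single z 1 : ι → ℝ≥0∞) x := by
  ext x
  rw [tsum_eq_single x]
  · simp
  · intro z hz; simp [hz.symm]

lemma mul_single_le (f : ι → ℝ≥0∞) (y : ι) : f y • (Pi.single y 1 : ι → ℝ≥0∞) ≤ f := by
  intro z
  by_cases h : z = y
  · subst h; simp
  · simp [h]

lemma single_le_one (y : ι) : (Pi.single y 1 : ι → ℝ≥0∞) ≤ 1 := by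
  simpa using mul_single_le 1 y

lemma op_pow_single_le_one (ha : ∀ x, ∑' z, a x z ≤ 1) (n : ℕ) (x y : ι) :
    (op a ^ n) (Pi.single y 1) x ≤ 1 :=
  (op_pow_mono (single_le_one y) n x).trans (op_pow_one_le ha x n)

lemma op_pow_single_mul_le (f : ι → ℝ≥0∞) (n : ℕ) (x y : ι) :
    (op a ^ n) (Pi.single y 1) x * f y ≤ (op a ^ n) f x := by
  have := op_pow_mono (a := a) (mul_single_le f y) n x
  rwa [map_smul, Pi.smul_apply, smul_eq_mul, mul_comm] at this

lemma op_pow_eq_tsum (f : ι → ℝ≥0∞) (n : ℕ) (x : ι) :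
    (op a ^ n) f x = ∑' y, (op a ^ n) (Pi.single y 1) x * f y := by
  induction n generalizing x with
  | zero =>
    conv_lhs => rw [eq_tsum_single f]
    simp [mul_comm]
  | succ n ih =>
    rw [op_pow_succ_apply, op_apply]
    simp_rw [ih, op_pow_succ_apply, op_apply, ← ENNReal.tsum_mul_right, ← ENNReal.tsum_mul_left]
    rw [ENNReal.tsum_comm]
    simp_rw [mul_assoc]

lemma op_taboo_single (hy : y ∈ B) : op (taboo a B) (Pi.single y 1) = 0 := by
  ext x; rw [op_single]; simp [taboo, hy]

/-- Maximum principle for the truncated Green functions of a substochastic matrix. -/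
lemma sum_op_pow_single_le (ha : ∀ x, ∑' z, a x z ≤ 1) (M : ℕ) (x y : ι) :
    ∑ n ∈ Finset.range M, (op a ^ n) (Pi.single y 1) x ≤
      ∑ n ∈ Finset.range M, (op a ^ n) (Pi.single y 1) y := by
  induction M generalizing x with
  | zero => simp
  | succ M ih =>
    by_cases hxy : x = y
    · rw [hxy]
    · set c := ∑ n ∈ Finset.range M, (op a ^ n) (Pi.single y 1) y
      have h1 : ∑ n ∈ Finset.range M, (op a ^ n) (Pi.single y 1) ≤ c • (1 : ι → ℝ≥0∞) :=
        fun z => by simpa using ih z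
      have h2 := op_mono (a := a) h1 x
      rw [map_smul, map_sum] at h2
      rw [Finset.sum_range_succ']
      simp only [op_pow_succ_apply, pow_zero, Module.End.one_apply, Pi.single_eq_of_ne hxy,
        add_zero]
      rw [← Finset.sum_apply]
      refine h2.trans ?_
      refine (mul_le_mul_right (op_one_le ha x) c).trans ?_
      simp only [Pi.one_apply, mul_one]
      exact Finset.sum_le_sum_of_subset (Finset.range_mono (Nat.le_succ M))

/-- Maximum principle for the Green function. -/
lemma green_le (ha : ∀ x, ∑' z, a x z ≤ 1) (x y : ι) : green a y x ≤ green a y y := by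
  refine ENNReal.tsum_le_of_sum_range_le fun M => ?_
  exact (sum_op_pow_single_le ha M x y).trans (ENNReal.sum_le_tsum _)

/-- The Green function of `y` is harmonic except at `y`. -/
lemma green_eq (y : ι) : green a y = Pi.single y 1 + op a (green a y) := by
  ext x
  unfold green
  rw [Pi.add_apply, op_tsum, tsum_eq_zero_add' ENNReal.summable]
  simp [op_pow_succ_apply]

/-- Outside `B ∋ y` the function `g = green a y` is harmonic. Hence the expectation of `g` at the
first return to `B` is at most its expectation after one step. -/
lemma hitOp_green_le (hy : y ∈ B) (x : ι) :
    hitOp a B (green a y) x ≤ op a (green a y) x := by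
  set g := green a y
  have hR : op (taboo a B) g = op (taboo a B) (op a g) := by
    conv_lhs => rw [show g = Pi.single y 1 + op a g from green_eq y]
    rw [map_add, op_taboo_single hy, zero_add]
  have key : ∀ N, ∑ n ∈ Finset.range N, (op (taboo a B) ^ n) (op (taboo a Bᶜ) g) +
      (op (taboo a B) ^ N) (op a g) = op a g := by
    intro N
    induction N with
    | zero => simp
    | succ N ih =>
      rw [Finset.sum_range_succ, op_pow_succ_apply', ← hR, add_assoc, ← map_add,
        add_comm (op _ g), ← LinearMap.add_apply, ← op_taboo_add, ih]
  refine ENNReal.tsum_le_of_sum_range_le fun N => ?_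
  conv_rhs => rw [← key N]
  simp

lemma op_taboo_compl_singleton (f : ι → ℝ≥0∞) :
    op (taboo a {y}ᶜ) f = f y • op (taboo a {y}ᶜ) 1 := by
  rw [← map_smul]
  refine op_taboo_congr fun z hz => ?_
  simp at hz
  simp [hz]

lemma hitOp_singleton (f : ι → ℝ≥0∞) (x y : ι) : hitOp a {y} f x = f y * hitOp a {y} 1 x := by
  unfold hitOp
  rw [op_taboo_compl_singleton f, ← ENNReal.tsum_mul_left]
  simp

/-- A finite Green function forces a positive probability of never returning. -/
lemma iInf_survive_ne_zero_of_green_lt_top (ha : ∀ x, ∑' z, a x z = 1) (h : green a x x < ⊤) :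
    ⨅ n, (op (taboo a {x}) ^ n) 1 x ≠ 0 := by
  intro h0
  have h1 := hitOp_one_add_iInf (B := {x}) ha x
  rw [h0, add_zero] at h1
  have h2 := hitOp_green_le (a := a) (Set.mem_singleton x) x
  rw [hitOp_singleton, h1, mul_one] at h2
  have h3 := congrFun (green_eq (a := a) x) x
  rw [Pi.add_apply, Pi.single_eq_same] at h3
  have h4 : green a x x + 1 ≤ green a x x := by
    conv_rhs => rw [h3]
    rw [add_comm]; gcongr
  exact (ENNReal.lt_add_right h.ne one_ne_zero).not_ge h4

/-- A positive probability of never returning forces a finite Green function. -/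
lemma green_lt_top_of_iInf_survive_ne_zero (ha : ∀ x, ∑' z, a x z = 1)
    (h : ⨅ n, (op (taboo a {x}) ^ n) 1 x ≠ 0) : green a x x < ⊤ := by
  set ε := ⨅ n, (op (taboo a {x}) ^ n) 1 x
  have hF := hitOp_one_add_iInf (B := {x}) ha x
  -- Apart from a visit at time `0`, visits to `x` occur only once `x` has been hit, and `c` bounds
  -- their mean number from then on.
  have key : ∀ M, ∀ c, ∑ n ∈ Finset.range M, (op a ^ n) (Pi.single x 1) x ≤ c →
      ∑ n ∈ Finset.range M, (op a ^ n) (Pi.single x 1) ≤ Pi.single x 1 + c • hitOp a {x} 1 := by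
    intro M
    induction M with
    | zero => intro c _; simp
    | succ M ih =>
      intro c hc
      have hc' : ∑ n ∈ Finset.range M, (op a ^ n) (Pi.single x 1) x ≤ c :=
        (Finset.sum_le_sum_of_subset (Finset.range_mono (Nat.le_succ M))).trans hc
      rw [Finset.sum_range_succ', add_comm]
      simp only [op_pow_succ_apply, pow_zero, Module.End.one_apply]
      refine add_le_add_right ?_ _
      rw [← map_sum]
      intro w
      have h1 := op_mono (a := taboo a {x}) (ih c hc') w
      rw [map_add, op_taboo_single (Set.mem_singleton x), zero_add, map_smul] at h1
      rw [op_eq_taboo_add a {x}, op_taboo_compl_singleton]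
      simp only [Pi.add_apply, Pi.smul_apply, smul_eq_mul, Finset.sum_apply] at h1 ⊢
      rw [hitOp_eq, mul_add, add_comm]
      exact add_le_add (mul_le_mul_left hc' _) h1
  have bound : ∀ M, ∑ n ∈ Finset.range M, (op a ^ n) (Pi.single x 1) x ≤ ε⁻¹ := by
    intro M
    set c := ∑ n ∈ Finset.range M, (op a ^ n) (Pi.single x 1) x
    have hc : c ≠ ⊤ := by
      refine ENNReal.sum_ne_top.2 fun n _ => ne_top_of_le_ne_top ENNReal.one_ne_top
        (op_pow_single_le_one (fun x => (ha x).le) n x x)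
    have h1 := key M c le_rfl x
    simp only [Finset.sum_apply, Pi.add_apply, Pi.single_eq_same, Pi.smul_apply, smul_eq_mul] at h1
    have h2 : c * hitOp a {x} 1 x + c * ε = c := by rw [← mul_add, hF, mul_one]
    have hle : hitOp a {x} 1 x ≤ 1 := by rw [← hF]; exact le_self_add
    have h3 : c * hitOp a {x} 1 x ≠ ⊤ :=
      ENNReal.mul_ne_top hc (ne_top_of_le_ne_top ENNReal.one_ne_top hle)
    have h4 : c * ε ≤ 1 := by
      refine (ENNReal.add_le_add_iff_left h3).1 ?_
      rw [h2, add_comm]; exact h1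
    exact ENNReal.le_inv_iff_mul_le.2 h4
  exact (ENNReal.tsum_le_of_sum_range_le bound).trans_lt (by simpa [pos_iff_ne_zero] using h)

/-- Finiteness of the Green function on the diagonal passes between communicating states. -/
lemma green_lt_top_of_communicate {m k : ℕ} (hm : (op a ^ m) (Pi.single y 1) x ≠ 0)
    (hk : (op a ^ k) (Pi.single x 1) y ≠ 0) (h : green a x x < ⊤) : green a y y < ⊤ := by
  set p := (op a ^ m) (Pi.single y 1) x
  set q := (op a ^ k) (Pi.single x 1) y
  have h1 : p * q * green a y y ≤ green a x x := by
    have : ∀ n, p * q * (op a ^ n) (Pi.single y 1) y ≤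
        (op a ^ (m + (n + k))) (Pi.single x 1) x := by
      intro n
      rw [pow_add, Module.End.mul_apply]
      refine le_trans ?_ (op_pow_single_mul_le _ m x y)
      rw [mul_assoc]
      gcongr
      rw [pow_add, Module.End.mul_apply, mul_comm]
      exact op_pow_single_mul_le _ n y y
    unfold green
    rw [← ENNReal.tsum_mul_left]
    refine (ENNReal.tsum_le_tsum this).trans ?_
    exact ENNReal.tsum_comp_le_tsum_of_injective (f := fun n => m + (n + k))
      (fun i j hij => by simpa using hij) (fun n => (op a ^ n) (Pi.single x 1) x)
  by_contra hc
  rw [not_lt, top_le_iff] at hc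
  rw [hc, ENNReal.mul_top (mul_ne_zero hm hk), top_le_iff] at h1
  exact h.ne h1

/-- If the mass of a substochastic matrix started at `x` eventually drops to one half, then `x` is
visited finitely often in the mean. -/
lemma green_lt_top_of_op_pow_one_le (ha : ∀ x, ∑' z, a x z ≤ 1) {N : ℕ}
    (h : (op a ^ N) 1 x ≤ 2⁻¹) : green a x x < ⊤ := by
  have hterm : ∀ n, (op a ^ n) (Pi.single x 1) x ≤ 1 := fun n => op_pow_single_le_one ha n x x
  have bound : ∀ M, ∑ n ∈ Finset.range M, (op a ^ n) (Pi.single x 1) x ≤ 2 * N := by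
    intro M
    set c := ∑ n ∈ Finset.range M, (op a ^ n) (Pi.single x 1) x
    have hc : c ≠ ⊤ := ENNReal.sum_ne_top.2 fun n _ =>
      ne_top_of_le_ne_top ENNReal.one_ne_top (hterm n)
    -- After `N` steps at most half of the mass is left, and the maximum principle bounds the
    -- number of visits it still makes.
    have h1 : c ≤ N + c * 2⁻¹ := by
      calc c ≤ ∑ n ∈ Finset.range (N + M), (op a ^ n) (Pi.single x 1) x :=
            Finset.sum_le_sum_of_subset (Finset.range_mono (by omega))
        _ = ∑ n ∈ Finset.range N, (op a ^ n) (Pi.single x 1) x +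
            ∑ n ∈ Finset.range M, (op a ^ (N + n)) (Pi.single x 1) x := Finset.sum_range_add _ _ _
        _ ≤ N + c * 2⁻¹ := by
          gcongr
          · calc _ ≤ ∑ n ∈ Finset.range N, (1 : ℝ≥0∞) := Finset.sum_le_sum fun n _ => hterm n
              _ = N := by simp
          · simp only [pow_add, Module.End.mul_apply]
            rw [← Finset.sum_apply, ← map_sum]
            have h2 : ∑ n ∈ Finset.range M, (op a ^ n) (Pi.single x 1) ≤ c • (1 : ι → ℝ≥0∞) :=
              fun z => by simpa using sum_op_pow_single_le ha M z x
            refine (op_pow_mono h2 N x).trans ?_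
            rw [map_smul, Pi.smul_apply, smul_eq_mul]
            gcongr
    have h3 : c * 2⁻¹ ≠ ⊤ := by finiteness
    have h4 : c * 2⁻¹ + c * 2⁻¹ = c := by rw [← mul_add, ENNReal.inv_two_add_inv_two, mul_one]
    have h5 : c * 2⁻¹ ≤ N := by
      refine (ENNReal.add_le_add_iff_right h3).1 ?_
      rw [h4]; exact h1
    calc c = 2 * (c * 2⁻¹) := by rw [two_mul, h4]
      _ ≤ 2 * N := by gcongr
  exact (ENNReal.tsum_le_of_sum_range_le bound).trans_lt (by finiteness)

end Potential

/-! ### Invariant measures and recurrence -/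

section Invariant

variable {ι : Type*} {a : ι → ι → ℝ≥0∞} {π : ι → ℝ≥0∞}

lemma op_taboo_eq (a : ι → ι → ℝ≥0∞) (B : Set ι) (f : ι → ℝ≥0∞) :
    op (taboo a B) f = op a (Bᶜ.indicator f) := by
  ext x
  refine tsum_congr fun z => ?_
  by_cases hz : z ∈ B <;> simp [taboo, hz]

lemma tsum_mul_op (hπ : ∀ w, ∑' z, π z * a z w = π w) (f : ι → ℝ≥0∞) :
    ∑' z, π z * op a f z = ∑' z, π z * f z := by
  simp_rw [op_apply, ← ENNReal.tsum_mul_left, ← mul_assoc]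
  rw [ENNReal.tsum_comm]
  simp_rw [ENNReal.tsum_mul_right, hπ]

lemma tsum_mul_op_pow (hπ : ∀ w, ∑' z, π z * a z w = π w) (f : ι → ℝ≥0∞) (n : ℕ) :
    ∑' z, π z * (op a ^ n) f z = ∑' z, π z * f z := by
  induction n with
  | zero => simp
  | succ n ih => rw [op_pow_succ_apply, tsum_mul_op hπ, ih]

lemma tsum_mul_eq_indicator_add (hπ : ∀ w, ∑' z, π z * a z w = π w) (B : Set ι)
    (f : ι → ℝ≥0∞) :
    ∑' z, π z * f z = ∑' z, B.indicator π z * f z + ∑' z, π z * op (taboo a B) f z := by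
  rw [op_taboo_eq, tsum_mul_op hπ, ← ENNReal.tsum_add]
  refine tsum_congr fun z => ?_
  by_cases hz : z ∈ B <;> simp [hz]

/-- The part of an invariant measure carried by `B`, transported along the excursions outside `B`,
is dominated by the invariant measure. -/
lemma tsum_excursion_le (hπ : ∀ w, ∑' z, π z * a z w = π w) (B : Set ι) (f : ι → ℝ≥0∞) :
    ∑' n, ∑' z, B.indicator π z * (op (taboo a B) ^ n) f z ≤ ∑' z, π z * f z := by
  refine ENNReal.tsum_le_of_sum_range_le fun N => ?_
  induction N generalizing f with
  | zero => simp
  | succ N ih =>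
    rw [Finset.sum_range_succ', tsum_mul_eq_indicator_add hπ B f, add_comm]
    simp only [op_pow_succ_apply']
    exact add_le_add (by simp) (ih _)

/-- One half of Kac's formula: the occupation measure of an excursion from `x` is at most the
invariant measure normalized at `x`. -/
lemma mul_tsum_survive_le (hπ : ∀ w, ∑' z, π z * a z w = π w) (x : ι) (f : ι → ℝ≥0∞) :
    π x * ∑' n, (op (taboo a {x}) ^ n) f x ≤ ∑' z, π z * f z := by
  refine le_trans (le_of_eq ?_) (tsum_excursion_le hπ {x} f)
  rw [← ENNReal.tsum_mul_left]
  refine tsum_congr fun n => ?_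
  rw [tsum_eq_single x]
  · simp
  · intro z hz; simp [hz]

/-- If a set `B` of finite invariant mass is almost surely hit after every start in `B`, then the
states of `B` charged by the invariant measure have an infinite Green function. Otherwise the Green
function `g` would be bounded, and integrating `g = 1_y + a g` over `B` against the invariant
measure would give `∫ g ≥ π y + ∫ g`, since the chain induced on `B` preserves that measure. -/
lemma green_eq_top_of_finite_recurrent_set [DecidableEq ι] (ha : ∀ x, ∑' z, a x z = 1)
    (hπ : ∀ w, ∑' z, π z * a z w = π w) {B : Set ι} (hB : ∑' z, B.indicator π z ≠ ⊤)
    (hhit : ∀ z ∈ B, hitOp a B 1 z = 1) {y : ι} (hy : y ∈ B) (hy0 : π y ≠ 0) :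
    green a y y = ⊤ := by
  by_contra hC
  set g := green a y
  set C := g y
  have hgC : ∀ z, g z ≤ C := fun z => green_le (fun x => (ha x).le) z y
  set φ : (ι → ℝ≥0∞) → ℝ≥0∞ := fun f => ∑' z, B.indicator π z * f z with hφ
  have φ_add : ∀ f h, φ (f + h) = φ f + φ h := fun f h => by
    simp [hφ, mul_add, ENNReal.tsum_add]
  have φ_mono : ∀ f h, f ≤ h → φ f ≤ φ h := fun f h hfh =>
    ENNReal.tsum_le_tsum fun z => mul_le_mul_right (hfh z) _
  have φ_fin : ∀ f, (∀ z, f z ≤ C) → φ f ≠ ⊤ := fun f hf => by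
    refine ne_top_of_le_ne_top ?_ (φ_mono f (fun _ => C) hf)
    simp only [hφ, ENNReal.tsum_mul_right]
    exact ENNReal.mul_ne_top hB hC
  have φ_hit : ∀ f, φ (hitOp a B f) ≤ φ f := fun f => by
    have h1 := tsum_excursion_le hπ B (op (taboo a Bᶜ) f)
    rw [ENNReal.tsum_comm] at h1
    simp_rw [ENNReal.tsum_mul_left] at h1
    refine h1.trans (le_of_eq ?_)
    rw [op_taboo_eq, compl_compl, tsum_mul_op hπ]
    refine tsum_congr fun z => ?_
    by_cases hz : z ∈ B <;> simp [hz]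
  have hit_add : ∀ f h, hitOp a B (f + h) = hitOp a B f + hitOp a B h := fun f h => by
    ext x; simp [hitOp, ENNReal.tsum_add]
  -- Stopping does not increase the integrals of `g` and of `C - g`, and preserves that of their
  -- sum, the constant `C`: hence it preserves the integral of `g`.
  set g' : ι → ℝ≥0∞ := fun z => C - g z
  have hsum : g + g' = C • (1 : ι → ℝ≥0∞) := by
    ext z; simp [g', add_tsub_cancel_of_le (hgC z)]
  have hhitC : φ (hitOp a B (C • (1 : ι → ℝ≥0∞))) = φ (C • (1 : ι → ℝ≥0∞)) := by
    refine tsum_congr fun z => ?_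
    by_cases hz : z ∈ B
    · have h2 : hitOp a B (C • (1 : ι → ℝ≥0∞)) z = C * hitOp a B 1 z := by
        simp [hitOp, ENNReal.tsum_mul_left]
      rw [h2, hhit z hz]; simp
    · simp [hz]
  have hg' : φ (hitOp a B g') ≠ ⊤ :=
    ne_top_of_le_ne_top (φ_fin g' fun z => tsub_le_self) (φ_hit g')
  have key : φ g ≤ φ (hitOp a B g) := by
    refine (ENNReal.add_le_add_iff_right hg').1 ?_
    rw [← φ_add (hitOp a B g), ← hit_add, hsum, hhitC, ← hsum, φ_add]
    exact add_le_add_right (φ_hit g') _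
  have h1 : φ g = π y + φ (op a g) := by
    conv_lhs => rw [show g = Pi.single y 1 + op a g from green_eq y]
    rw [φ_add]
    congr 1
    simp only [hφ]
    rw [tsum_eq_single y (fun z hz => by simp [hz])]
    simp [hy]
  have h2 : φ g + π y ≤ φ g := by
    calc φ g + π y ≤ φ (op a g) + π y :=
          add_le_add_left (key.trans (φ_mono _ _ (hitOp_green_le hy))) _
      _ = φ g := by rw [h1, add_comm]
  exact (ENNReal.lt_add_right (φ_fin g hgC) hy0).not_ge h2

/-- Kac's formula: at a recurrent state `x` that is reached from everywhere, an invariant measure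
is the multiple `π x` of the occupation measure of an excursion from `x`. -/
lemma tsum_eq_mul_tsum_survive [DecidableEq ι] (ha : ∀ x, ∑' z, a x z = 1)
    (hπ : ∀ w, ∑' z, π z * a z w = π w) {x : ι} (hx : π x ≠ ⊤)
    (hreach : ∀ z, ∃ k, (op a ^ k) (Pi.single x 1) z ≠ 0)
    (hrec : ⨅ n, (op (taboo a {x}) ^ n) 1 x = 0) :
    ∑' z, π z = π x * ∑' n, (op (taboo a {x}) ^ n) 1 x := by
  have hhit := hitOp_one_add_iInf (B := {x}) ha x
  rw [hrec, add_zero] at hhit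
  -- `m` is the integral against the occupation measure of an excursion from `x`.
  set m : (ι → ℝ≥0∞) → ℝ≥0∞ := fun f => ∑' n, (op (taboo a {x}) ^ n) f x with hm
  have m_op : ∀ f, m (op a f) = m f := fun f => by
    have h1 : m (op a f) = m (op (taboo a {x}) f) + hitOp a {x} f x := by
      simp only [hm, hitOp, ← ENNReal.tsum_add]
      refine tsum_congr fun n => ?_
      rw [op_eq_taboo_add a {x}, map_add, Pi.add_apply]
    rw [h1, hitOp_singleton, hhit, mul_one]
    simp only [hm]
    conv_rhs => rw [tsum_eq_zero_add' ENNReal.summable]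
    simp [op_pow_succ_apply', add_comm]
  have m_pow : ∀ k f, m ((op a ^ k) f) = m f := fun k f => by
    induction k with
    | zero => simp
    | succ k ih => rw [op_pow_succ_apply, m_op, ih]
  have m_tsum : ∀ f, m f = ∑' z, m (Pi.single z 1) * f z := fun f => by
    simp only [hm, ← ENNReal.tsum_mul_right]
    rw [ENNReal.tsum_comm]
    exact tsum_congr fun n => op_pow_eq_tsum f n x
  have m_single : m (Pi.single x 1) = 1 := by
    simp only [hm]
    rw [tsum_eq_zero_add' ENNReal.summable]
    simp [op_pow_succ_apply', op_taboo_single (Set.mem_singleton x)]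
  have hle : ∀ z, π x * m (Pi.single z 1) ≤ π z := fun z => by
    refine (mul_tsum_survive_le hπ x (Pi.single z 1)).trans (le_of_eq ?_)
    rw [tsum_eq_single z (fun w hw => by simp [hw])]
    simp
  -- Both measures are invariant and they agree at `x`; a strict inequality at `z` would be carried
  -- to `x` by a path from `z` to `x`.
  have heq : ∀ z, π x * m (Pi.single z 1) = π z := by
    intro z
    obtain ⟨k, hk⟩ := hreach z
    refine le_antisymm (hle z) (not_lt.1 fun hlt => ?_)
    set w := (op a ^ k) (Pi.single x 1)
    have hw1 : w z ≤ 1 := op_pow_single_le_one (fun x => (ha x).le) k z x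
    have e1 : ∑' v, π x * m (Pi.single v 1) * w v = π x := by
      simp_rw [mul_assoc]
      rw [ENNReal.tsum_mul_left, ← m_tsum, m_pow, m_single, mul_one]
    have e2 : ∑' v, π v * w v = π x := by
      rw [tsum_mul_op_pow hπ, tsum_eq_single x (fun v hv => by simp [hv])]
      simp
    have : ∑' v, π x * m (Pi.single v 1) * w v < ∑' v, π v * w v := by
      refine ENNReal.tsum_lt_tsum (i := z) (by rw [e1]; exact hx)
        (fun v => mul_le_mul_left (hle v) _) ?_
      exact ENNReal.mul_lt_mul_left hk (ne_top_of_le_ne_top ENNReal.one_ne_top hw1) hlt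
    rw [e1, e2] at this
    exact lt_irrefl _ this
  calc ∑' z, π z = ∑' z, π x * m (Pi.single z 1) := tsum_congr fun z => (heq z).symm
    _ = π x * m 1 := by rw [ENNReal.tsum_mul_left, m_tsum 1]; simp

end Invariant

/-! ### Trajectories and powers of the transition matrix -/

section Bridge

variable (p : Kernel ℤ ℤ)

/-- The transition matrix of a kernel on `ℤ`. -/
def transMat (x y : ℤ) : ℝ≥0∞ := p x {y}

lemma op_transMat (f : ℤ → ℝ≥0∞) (x : ℤ) : op (transMat p) f x = ∫⁻ z, f z ∂(p x) := by
  rw [lintegral_countable', op_apply]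
  exact tsum_congr fun z => mul_comm _ _

variable [IsMarkovKernel p]

lemma transMat_tsum (x : ℤ) : ∑' y, transMat p x y = 1 := by
  have h := op_transMat p 1 x
  simpa [op_apply] using h

instance (x : ℤ) : IsProbabilityMeasure (pathLaw p x) := by unfold pathLaw; infer_instance

lemma lintegral_pathLaw_zero (x : ℤ) (f : ℤ → ℝ≥0∞) :
    ∫⁻ ω, f (ω 0) ∂(pathLaw p x) = f x := by
  have h := Kernel.traj_map_frestrictLe_apply (X := fun _ => ℤ)
    (κ := fun n => p.comap (fun h : (i : Finset.Iic n) → ℤ => h ⟨n, Finset.mem_Iic.2 le_rfl⟩)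
      (measurable_pi_apply _)) 0 0 (fun _ => x)
  rw [Kernel.partialTraj_self, Kernel.id_apply] at h
  have h2 : ∫⁻ ω, f (ω 0) ∂(pathLaw p x) =
      ∫⁻ η, f (η ⟨0, by simp⟩)
        ∂((pathLaw p x).map (Preorder.frestrictLe (π := fun _ : ℕ => ℤ) 0)) := by
    rw [lintegral_map]
    · rfl
    · exact Measurable.comp Measurable.of_discrete (measurable_pi_apply _)
    · fun_prop
  rw [h2]
  unfold pathLaw
  rw [h, lintegral_dirac']
  exact Measurable.comp Measurable.of_discrete (measurable_pi_apply _)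

/-- The one-step Markov property. -/
lemma lintegral_pathLaw_succ (x : ℤ) (n : ℕ) (Φ : ((i : Finset.Iic n) → ℤ) → ℝ≥0∞)
    (hΦ : Measurable Φ) (f : ℤ → ℝ≥0∞) :
    ∫⁻ ω, Φ (Preorder.frestrictLe n ω) * f (ω (n + 1)) ∂(pathLaw p x) =
      ∫⁻ ω, Φ (Preorder.frestrictLe n ω) * op (transMat p) f (ω n) ∂(pathLaw p x) := by
  have h := Kernel.partialTraj_compProd_eq_map_traj (X := fun _ => ℤ)
    (κ := fun n => p.comap (fun h : (i : Finset.Iic n) → ℤ => h ⟨n, Finset.mem_Iic.2 le_rfl⟩)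
      (measurable_pi_apply _)) (Nat.zero_le n) (x₀ := fun _ => x)
  have h' := Kernel.traj_map_frestrictLe_apply (X := fun _ => ℤ)
    (κ := fun n => p.comap (fun h : (i : Finset.Iic n) → ℤ => h ⟨n, Finset.mem_Iic.2 le_rfl⟩)
      (measurable_pi_apply _)) 0 n (fun _ => x)
  have hF : Measurable fun q : ((i : Finset.Iic n) → ℤ) × ℤ => Φ q.1 * f q.2 :=
    (hΦ.comp measurable_fst).mul (Measurable.comp Measurable.of_discrete measurable_snd)
  calc ∫⁻ ω, Φ (Preorder.frestrictLe n ω) * f (ω (n + 1)) ∂(pathLaw p x)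
      = ∫⁻ q, Φ q.1 * f q.2 ∂((pathLaw p x).map
          (fun ω => (Preorder.frestrictLe (π := fun _ : ℕ => ℤ) n ω, ω (n + 1)))) := by
        rw [lintegral_map hF (by fun_prop)]
    _ = _ := by
        unfold pathLaw
        rw [← h, Measure.lintegral_compProd hF, ← h', lintegral_map]
        · refine lintegral_congr fun ω => ?_
          simp only [Kernel.comap_apply]
          rw [lintegral_const_mul _ Measurable.of_discrete, op_transMat]
          rfl
        · refine Measurable.lintegral_kernel_prod_right' hF
        · fun_prop

/-- The trajectories that stay outside `B` at the times `1, …, n`. -/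
def avoid (B : Set ℤ) (n : ℕ) : Set (ℕ → ℤ) := {ω | ∀ i, 1 ≤ i → i ≤ n → ω i ∉ B}

lemma measurableSet_avoid (B : Set ℤ) (n : ℕ) : MeasurableSet (avoid B n) := by
  have : avoid B n = ⋂ (i : ℕ) (_ : 1 ≤ i) (_ : i ≤ n), (fun ω : ℕ → ℤ => ω i) ⁻¹' Bᶜ := by
    ext ω; simp [avoid]
  rw [this]
  exact MeasurableSet.iInter fun i => .iInter fun _ => .iInter fun _ =>
    measurable_pi_apply i (MeasurableSet.of_discrete (s := Bᶜ))

/-- The Markov property on the trajectories that have avoided `B` up to time `n`. -/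
lemma lintegral_avoid_succ (B : Set ℤ) (x : ℤ) (n : ℕ) (f : ℤ → ℝ≥0∞) :
    ∫⁻ ω, (avoid B n).indicator 1 ω * f (ω (n + 1)) ∂(pathLaw p x) =
      ∫⁻ ω, (avoid B n).indicator 1 ω * op (transMat p) f (ω n) ∂(pathLaw p x) := by
  -- the indicator of `avoid B n` is a function of the first coordinates of the trajectory
  set Φ : ((i : Finset.Iic n) → ℤ) → ℝ≥0∞ := fun η =>
    (avoid B n).indicator 1 (fun i => if h : i ≤ n then η ⟨i, Finset.mem_Iic.2 h⟩ else 0) with hΦ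
  have hΦm : Measurable Φ := by
    refine (measurable_const.indicator (measurableSet_avoid B n)).comp
      (measurable_pi_lambda _ fun i => ?_)
    by_cases h : i ≤ n
    · simp only [h, dite_true]; exact measurable_pi_apply _
    · simp only [h, dite_false]; exact measurable_const
  have hΦω : ∀ ω : ℕ → ℤ, Φ (Preorder.frestrictLe n ω) = (avoid B n).indicator 1 ω := by
    intro ω
    have : (fun i => if h : i ≤ n then Preorder.frestrictLe (π := fun _ : ℕ => ℤ) n ω
        ⟨i, Finset.mem_Iic.2 h⟩ else 0) ∈ avoid B n ↔ ω ∈ avoid B n := by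
      refine forall_congr' fun i => forall_congr' fun _ => forall_congr' fun h => ?_
      simp [h]
    by_cases hω : ω ∈ avoid B n
    · rw [Set.indicator_of_mem hω]
      exact Set.indicator_of_mem (this.2 hω) _
    · rw [Set.indicator_of_notMem hω]
      exact Set.indicator_of_notMem (fun h => hω (this.1 h)) _
  simp_rw [← hΦω]
  exact lintegral_pathLaw_succ p x n Φ hΦm _

/-- Powers of the taboo operator are expectations over the trajectories avoiding the taboo set. -/
lemma lintegral_avoid (B : Set ℤ) (x : ℤ) (n : ℕ) (f : ℤ → ℝ≥0∞) :
    ∫⁻ ω, (avoid B n).indicator 1 ω * f (ω n) ∂(pathLaw p x) =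
      (op (taboo (transMat p) B) ^ n) f x := by
  induction n generalizing f with
  | zero =>
    have : avoid B 0 = Set.univ := by ext ω; simp [avoid]; omega
    simp [this, lintegral_pathLaw_zero]
  | succ n ih =>
    rw [op_pow_succ_apply', ← ih, op_taboo_eq, ← lintegral_avoid_succ]
    refine lintegral_congr fun ω => ?_
    have : ω ∈ avoid B (n + 1) ↔ ω ∈ avoid B n ∧ ω (n + 1) ∉ B := by
      refine ⟨fun h => ⟨fun i h1 h2 => h i h1 (by omega), h _ (by omega) le_rfl⟩,
        fun h i h1 h2 => ?_⟩
      rcases Nat.lt_or_ge n i with h3 | h3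
      · obtain rfl : i = n + 1 := by omega
        exact h.2
      · exact h.1 i h1 h3
    by_cases ha : ω ∈ avoid B n <;> by_cases hb : ω (n + 1) ∈ B <;>
      simp [Set.indicator, this, ha, hb]

lemma pathLaw_avoid (B : Set ℤ) (x : ℤ) (n : ℕ) :
    pathLaw p x (avoid B n) = (op (taboo (transMat p) B) ^ n) 1 x := by
  rw [← lintegral_avoid, ← lintegral_indicator_one (measurableSet_avoid B n)]
  simp

lemma taboo_empty {ι : Type*} (a : ι → ι → ℝ≥0∞) : taboo a ∅ = a := by
  ext x z; simp [taboo]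

lemma pathLaw_eval (x y : ℤ) (n : ℕ) :
    pathLaw p x {ω | ω n = y} = (op (transMat p) ^ n) (Pi.single y 1) x := by
  have h := lintegral_avoid p ∅ x n (Pi.single y 1)
  have hm : MeasurableSet {ω : ℕ → ℤ | ω n = y} := measurableSet_eq_fun (by fun_prop) (by fun_prop)
  rw [taboo_empty] at h
  rw [← h, ← lintegral_indicator_one hm]
  refine lintegral_congr fun ω => ?_
  by_cases h2 : ω n = y <;> simp [Set.indicator, avoid, h2]

lemma lt_passageTime_iff (y : ℤ) (ω : ℕ → ℤ) (n : ℕ) :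
    (n : ℕ∞) < passageTime y ω ↔ ω ∈ avoid {y} n := by
  unfold passageTime
  constructor
  · intro h i h1 h2 h3
    have := (iInf₂_le (f := fun (n : ℕ) (_ : 1 ≤ n ∧ ω n = y) => (n : ℕ∞)) i ⟨h1, h3⟩)
    have h4 := h.trans_le this
    have : n < i := by exact_mod_cast h4
    omega
  · intro h
    have : ((n + 1 : ℕ) : ℕ∞) ≤ ⨅ (n : ℕ) (_ : 1 ≤ n ∧ ω n = y), (n : ℕ∞) := by
      refine le_iInf₂ fun i hi => ?_
      have : n + 1 ≤ i := by
        by_contra hc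
        exact h i hi.1 (by omega) hi.2
      exact_mod_cast this
    refine lt_of_lt_of_le ?_ this
    exact_mod_cast Nat.lt_succ_self n

lemma passageTime_lt_top_compl (y : ℤ) :
    {ω | passageTime y ω < ⊤}ᶜ = ⋂ n, avoid {y} n := by
  ext ω
  simp only [Set.mem_compl_iff, Set.mem_ofPred_eq, not_lt, top_le_iff, Set.mem_iInter,
    ← lt_passageTime_iff]
  exact (ENat.eq_top_iff_forall_gt)

lemma pathLaw_passageTime_compl (x y : ℤ) :
    pathLaw p x {ω | passageTime y ω < ⊤}ᶜ = ⨅ n, (op (taboo (transMat p) {y}) ^ n) 1 x := by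
  rw [passageTime_lt_top_compl]
  have hanti : Antitone fun n => avoid ({y} : Set ℤ) n := fun m n hmn ω h i h1 h2 =>
    h i h1 (h2.trans hmn)
  rw [hanti.measure_iInter (fun n => (measurableSet_avoid _ n).nullMeasurableSet)
    ⟨0, measure_ne_top _ _⟩]
  simp_rw [pathLaw_avoid]

lemma measurableSet_passageTime (y : ℤ) : MeasurableSet {ω | passageTime y ω < ⊤} := by
  rw [← MeasurableSet.compl_iff, passageTime_lt_top_compl]
  exact MeasurableSet.iInter fun n => measurableSet_avoid _ n

lemma pathLaw_passageTime_eq_one_iff (x y : ℤ) :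
    pathLaw p x {ω | passageTime y ω < ⊤} = 1 ↔
      ⨅ n, (op (taboo (transMat p) {y}) ^ n) 1 x = 0 := by
  rw [← pathLaw_passageTime_compl, prob_compl_eq_zero_iff (measurableSet_passageTime y)]

lemma pathLaw_passageTime_lt_one_iff (x y : ℤ) :
    pathLaw p x {ω | passageTime y ω < ⊤} < 1 ↔
      ⨅ n, (op (taboo (transMat p) {y}) ^ n) 1 x ≠ 0 := by
  rw [Ne, ← pathLaw_passageTime_eq_one_iff, prob_le_one.lt_iff_ne]

lemma enat_toENNReal_eq_tsum (t : ℕ∞) :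
    (t : ℝ≥0∞) = ∑' n : ℕ, if (n : ℕ∞) < t then 1 else 0 := by
  induction t using ENat.recTopCoe with
  | top => simp
  | coe m =>
    rw [tsum_eq_sum (s := Finset.range m)]
    · rw [Finset.sum_congr rfl (g := fun _ => 1)]
      · simp
      · intro n hn; simpa using hn
    · intro n hn; simpa using hn

lemma lintegral_passageTime (x y : ℤ) :
    ∫⁻ ω, (passageTime y ω : ℝ≥0∞) ∂(pathLaw p x) =
      ∑' n, (op (taboo (transMat p) {y}) ^ n) 1 x := by
  have h : ∀ ω, (passageTime y ω : ℝ≥0∞) = ∑' n, (avoid {y} n).indicator 1 ω := fun ω => by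
    rw [enat_toENNReal_eq_tsum]
    refine tsum_congr fun n => ?_
    by_cases hω : ω ∈ avoid {y} n
    · rw [Set.indicator_of_mem hω, if_pos ((lt_passageTime_iff y ω n).2 hω), Pi.one_apply]
    · rw [Set.indicator_of_notMem hω, if_neg (fun h => hω ((lt_passageTime_iff y ω n).1 h))]
  simp_rw [h]
  rw [lintegral_tsum fun n =>
    (measurable_one.indicator (measurableSet_avoid _ n)).aemeasurable]
  refine tsum_congr fun n => ?_
  rw [lintegral_indicator_one (measurableSet_avoid _ _), pathLaw_avoid]

end Bridge

/-! ### Entrance laws -/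

section Entrance

lemma hitOp_eq_tsum {ι : Type*} [DecidableEq ι] (a : ι → ι → ℝ≥0∞) (B : Set ι) (f : ι → ℝ≥0∞)
    (x : ι) : hitOp a B f x = ∑' k, hitOp a B (Pi.single k 1) x * f k := by
  simp only [hitOp, ← ENNReal.tsum_mul_right]
  rw [ENNReal.tsum_comm]
  refine tsum_congr fun n => ?_
  rw [op_pow_eq_tsum]
  simp_rw [op_pow_eq_tsum (op (taboo a Bᶜ) (Pi.single _ 1)), op_single, op_apply,
    ← ENNReal.tsum_mul_left, ← ENNReal.tsum_mul_right, mul_assoc]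
  exact ENNReal.tsum_comm

variable (μ : Measure ℤ) [IsProbabilityMeasure μ] {B : Set ℤ}

lemma entranceLaw_singleton (k : ℤ) : entranceLaw μ B {k} =
    pathLaw (homWalk μ) 0 {ω | ∃ n : ℕ, ω n = k ∧ k ∈ B ∧ ∀ m < n, ω m ∉ B} := by
  rw [entranceLaw, Measure.sum_apply _ (MeasurableSet.singleton k), tsum_eq_single k]
  · simp
  · intro j hj; simp [hj]

lemma entranceLaw_singleton_of_notMem {k : ℤ} (hk : k ∉ B) : entranceLaw μ B {k} = 0 := by
  rw [entranceLaw_singleton]; simp [hk]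

lemma entranceLaw_singleton_eq (h0 : (0 : ℤ) ∉ B) (k : ℤ) :
    entranceLaw μ B {k} = hitOp (transMat (homWalk μ)) B (Pi.single k 1) 0 := by
  by_cases hk : k ∈ B
  swap
  · rw [entranceLaw_singleton_of_notMem μ hk]
    simp [hitOp, op_taboo_single (show k ∈ Bᶜ from hk)]
  rw [entranceLaw_singleton]
  -- `E n` is the event that `B` is entered at `k` at time `n + 1`; time `0` is excluded as `0 ∉ B`.
  set E : ℕ → Set (ℕ → ℤ) := fun n => avoid B n ∩ {ω | ω (n + 1) = k}
  have hEm : ∀ n, MeasurableSet (E n) := fun n =>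
    (measurableSet_avoid B n).inter (measurableSet_eq_fun (by fun_prop) (by fun_prop))
  have h1 : {ω : ℕ → ℤ | ∃ n : ℕ, ω n = k ∧ k ∈ B ∧ ∀ m < n, ω m ∉ B}
      =ᵐ[pathLaw (homWalk μ) 0] ⋃ n, E n := by
    have hz : ∀ᵐ ω ∂(pathLaw (homWalk μ) 0), ω 0 = 0 := by
      have h := pathLaw_eval (homWalk μ) 0 0 0
      rw [pow_zero, Module.End.one_apply, Pi.single_eq_same] at h
      exact (prob_compl_eq_zero_iff (measurableSet_eq_fun (by fun_prop) (by fun_prop))).2 h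
    filter_upwards [hz] with ω hω
    refine propext ?_
    change (∃ n : ℕ, ω n = k ∧ k ∈ B ∧ ∀ m < n, ω m ∉ B) ↔ ω ∈ ⋃ n, E n
    rw [Set.mem_iUnion]
    constructor
    · rintro ⟨n, h1, -, h2⟩
      cases n with
      | zero => rw [hω] at h1; subst h1; exact absurd hk h0
      | succ n => exact ⟨n, fun i _ hi => h2 i (by omega), h1⟩
    · rintro ⟨n, h1, h2⟩
      refine ⟨n + 1, h2, hk, fun m hm => ?_⟩
      cases m with
      | zero => rw [hω]; exact h0
      | succ m => exact h1 _ (by omega) (by omega)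
  have hdisj : Pairwise (Function.onFun Disjoint E) := by
    intro i j hij
    refine Set.disjoint_left.2 fun ω h1 h2 => ?_
    rcases Nat.lt_or_gt_of_ne hij with h | h
    · exact h2.1 (i + 1) (by omega) (by omega) (by rw [show ω (i + 1) = k from h1.2]; exact hk)
    · exact h1.1 (j + 1) (by omega) (by omega) (by rw [show ω (j + 1) = k from h2.2]; exact hk)
  rw [measure_congr h1, measure_iUnion hdisj hEm]
  refine tsum_congr fun n => ?_
  have h2 : op (taboo (transMat (homWalk μ)) Bᶜ) (Pi.single k 1) =
      op (transMat (homWalk μ)) (Pi.single k 1) := by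
    rw [op_taboo_eq, compl_compl]
    congr 1
    ext z
    by_cases hz : z = k
    · subst hz; simp [hk]
    · simp [hz]
  rw [h2, ← lintegral_avoid, ← lintegral_avoid_succ, ← lintegral_indicator_one (hEm n)]
  refine lintegral_congr fun ω => ?_
  by_cases h3 : ω ∈ avoid B n <;> by_cases h4 : ω (n + 1) = k <;>
    simp [E, Set.indicator, h3, h4]

lemma lintegral_entranceLaw (h0 : (0 : ℤ) ∉ B) (f : ℤ → ℝ≥0∞) :
    ∫⁻ k, f k ∂(entranceLaw μ B) = hitOp (transMat (homWalk μ)) B f 0 := by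
  rw [lintegral_countable', hitOp_eq_tsum]
  refine tsum_congr fun k => ?_
  rw [entranceLaw_singleton_eq μ h0, mul_comm]

end Entrance

/-! ### The chain of ladder jumps: invariant measure and recurrence -/

section Osc

lemma op_walkKernel (σ : ℤ → Measure ℤ) (f : ℤ → ℝ≥0∞) (x : ℤ) :
    op (transMat (walkKernel σ)) f x = ∫⁻ k, f (x + k) ∂(σ x) := by
  rw [op_transMat]
  exact lintegral_map Measurable.of_discrete Measurable.of_discrete

lemma transMat_walkKernel (σ : ℤ → Measure ℤ) (x y : ℤ) :
    transMat (walkKernel σ) x y = σ x {y - x} := by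
  have : transMat (walkKernel σ) x y = (σ x).map (fun k => x + k) {y} := rfl
  rw [this, Measure.map_apply Measurable.of_discrete (MeasurableSet.singleton y)]
  congr 1
  ext k; simp; omega

variable {α β : Measure ℤ}

lemma measure_eq_tsum_ite (m : Measure ℤ) (P : ℤ → Prop) [DecidablePred P] :
    m {k | P k} = ∑' k, if P k then m {k} else 0 := by
  rw [← Measure.tsum_indicator_apply_singleton m _ (MeasurableSet.of_discrete)]
  exact tsum_congr fun k => by simp [Set.indicator]

/-- The density of `piMeasure α β` with respect to the counting measure. -/
def piWeight (α β : Measure ℤ) (y : ℤ) : ℝ≥0∞ :=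
  if 1 ≤ y then α (Set.Ici y) else β (Set.Iic (y - 1))

lemma piMeasure_singleton (y : ℤ) : piMeasure α β {y} = piWeight α β y := by
  rw [piMeasure, withDensity_apply _ (MeasurableSet.singleton y), Measure.restrict_singleton]
  simp [piWeight]

variable [IsProbabilityMeasure α] [IsProbabilityMeasure β]

lemma tsum_singleton (m : Measure ℤ) [IsProbabilityMeasure m] : ∑' k, m {k} = 1 := by
  have h := Measure.tsum_indicator_apply_singleton m Set.univ MeasurableSet.univ
  simpa using h

/-- `piWeight α β` is invariant: for independent `X` of law `α` and `Y` of law `β`, both sides are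
the probability of the same event, `{X ≥ y}` or `{Y ≤ y - 1}`, split according to whether
`X + Y ≥ y`. -/
lemma piWeight_invariant (hα : ∀ k ≤ 0, α {k} = 0) (hβ : ∀ k, 0 ≤ k → β {k} = 0) (y : ℤ) :
    ∑' x, piWeight α β x * transMat (oscWalk α β) x y = piWeight α β y := by
  have h1 : ∀ x, piWeight α β x * transMat (oscWalk α β) x y =
      (∑' j, if x ≤ 0 ∧ j ≤ x - 1 then β {j} * α {y - x} else 0) +
        ∑' k, if 1 ≤ x ∧ x ≤ k then α {k} * β {y - x} else 0 := by
    intro x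
    rw [transMat_walkKernel, oscStep, piWeight]
    rcases le_or_gt x 0 with hx | hx
    · have h2 : ¬ (1 ≤ x) := by omega
      have h3 : β (Set.Iic (x - 1)) = _ := measure_eq_tsum_ite β (fun j => j ≤ x - 1)
      simp only [h2, hx, if_true, if_false, false_and, true_and, tsum_zero, add_zero, h3,
        ← ENNReal.tsum_mul_right, ite_mul, zero_mul]
    · have h2 : ¬ (x ≤ 0) := by omega
      have h4 : 1 ≤ x := by omega
      have h3 : α (Set.Ici x) = _ := measure_eq_tsum_ite α (fun j => x ≤ j)
      simp only [h2, h4, if_true, if_false, false_and, true_and, tsum_zero, zero_add, h3,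
        ← ENNReal.tsum_mul_right, ite_mul, zero_mul]
  simp_rw [h1]
  rw [ENNReal.tsum_add]
  have e1 : (∑' x, ∑' j, if x ≤ 0 ∧ j ≤ x - 1 then β {j} * α {y - x} else 0) =
      ∑' k, ∑' j, if y - k ≤ 0 ∧ j ≤ y - k - 1 then α {k} * β {j} else 0 := by
    rw [← (Equiv.subLeft y).tsum_eq]
    simp [mul_comm]
  have e2 : (∑' x, ∑' k, if 1 ≤ x ∧ x ≤ k then α {k} * β {y - x} else 0) =
      ∑' k, ∑' j, if 1 ≤ y - j ∧ y - j ≤ k then α {k} * β {j} else 0 := by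
    rw [← (Equiv.subLeft y).tsum_eq, ENNReal.tsum_comm]
    simp
  have e3 : piWeight α β y =
      ∑' k, ∑' j, if (1 ≤ y ∧ y ≤ k) ∨ (y ≤ 0 ∧ j ≤ y - 1) then α {k} * β {j} else 0 := by
    rw [piWeight]
    rcases le_or_gt y 0 with hy | hy
    · have h2 : ¬ (1 ≤ y) := by omega
      have h3 : β (Set.Iic (y - 1)) = _ := measure_eq_tsum_ite β (fun j => j ≤ y - 1)
      rw [ENNReal.tsum_comm]
      simp only [h2, hy, if_false, false_and, true_and, false_or, h3]
      refine tsum_congr fun j => ?_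
      split_ifs
      · rw [ENNReal.tsum_mul_right, tsum_singleton, one_mul]
      · simp
    · have h2 : ¬ (y ≤ 0) := by omega
      have h4 : 1 ≤ y := by omega
      have h3 : α (Set.Ici y) = _ := measure_eq_tsum_ite α (fun j => y ≤ j)
      simp only [h2, h4, if_true, false_and, true_and, or_false, h3]
      refine tsum_congr fun j => ?_
      split_ifs
      · rw [ENNReal.tsum_mul_left, tsum_singleton, mul_one]
      · simp
  rw [e1, e2, e3, ← ENNReal.tsum_add]
  refine tsum_congr fun k => ?_
  rw [← ENNReal.tsum_add]
  refine tsum_congr fun j => ?_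
  rcases le_or_gt k 0 with hk | hk
  · simp [hα k hk]
  rcases le_or_gt 0 j with hj | hj
  · simp [hβ j hj]
  split_ifs <;> first | omega | simp

lemma piMeasure_invariant (hα : ∀ k ≤ 0, α {k} = 0) (hβ : ∀ k, 0 ≤ k → β {k} = 0) :
    Kernel.Invariant (oscWalk α β) (piMeasure α β) := by
  refine Measure.ext_of_singleton fun y => ?_
  rw [Measure.bind_apply (MeasurableSet.singleton y) (Kernel.aemeasurable _),
    lintegral_countable', piMeasure_singleton, ← piWeight_invariant hα hβ]
  exact tsum_congr fun x => by rw [piMeasure_singleton, mul_comm]; rfl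

omit [IsProbabilityMeasure α] [IsProbabilityMeasure β] in
lemma tsum_piWeight_Ici (hα : ∀ k ≤ 0, α {k} = 0) :
    ∑' y, (Set.Ici 1).indicator (piWeight α β) y = ∫⁻ k : ℤ, ‖(k : ℝ)‖ₑ ∂α := by
  have h1 : ∀ y, (Set.Ici 1).indicator (piWeight α β) y =
      ∑' k, if 1 ≤ y ∧ y ≤ k then α {k} else 0 := fun y => by
    by_cases hy : 1 ≤ y
    · have h3 : α (Set.Ici y) = _ := measure_eq_tsum_ite α (fun j => y ≤ j)
      simp [Set.indicator, piWeight, hy, h3]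
    · simp [Set.indicator, hy]
  simp_rw [h1]
  rw [ENNReal.tsum_comm, lintegral_countable']
  refine tsum_congr fun k => ?_
  rcases le_or_gt k 0 with hk | hk
  · simp [hα k hk]
  rw [tsum_eq_sum (s := Finset.Icc 1 k) (fun b hb => if_neg (by simpa using hb)),
    Finset.sum_congr rfl (g := fun _ => α {k}) (fun b hb => if_pos (by simpa using hb))]
  obtain ⟨n, rfl⟩ := Int.eq_ofNat_of_zero_le hk.le
  simp

omit [IsProbabilityMeasure α] [IsProbabilityMeasure β] in
lemma tsum_piWeight_Iic (hβ : ∀ k, 0 ≤ k → β {k} = 0) :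
    ∑' y, (Set.Iic 0).indicator (piWeight α β) y = ∫⁻ k : ℤ, ‖(k : ℝ)‖ₑ ∂β := by
  have h1 : ∀ y, (Set.Iic 0).indicator (piWeight α β) y =
      ∑' k, if y ≤ 0 ∧ k ≤ y - 1 then β {k} else 0 := fun y => by
    by_cases hy : y ≤ 0
    · have h3 : β (Set.Iic (y - 1)) = _ := measure_eq_tsum_ite β (fun j => j ≤ y - 1)
      have h4 : ¬ (1 ≤ y) := by omega
      simp [Set.indicator, piWeight, hy, h3, h4]
    · simp [Set.indicator, hy]
  simp_rw [h1]
  rw [ENNReal.tsum_comm, lintegral_countable']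
  refine tsum_congr fun k => ?_
  rcases le_or_gt 0 k with hk | hk
  · simp [hβ k hk]
  rw [tsum_eq_sum (s := Finset.Icc (k + 1) 0) (fun b hb => if_neg (by simp at hb; omega)),
    Finset.sum_congr rfl (g := fun _ => β {k}) (fun b hb => if_pos (by simp at hb; omega))]
  obtain ⟨n, hn⟩ := Int.eq_ofNat_of_zero_le (show 0 ≤ -k by omega)
  obtain rfl : k = -n := by omega
  simp

lemma integrable_iff (m : Measure ℤ) :
    Integrable (fun k : ℤ => (k : ℝ)) m ↔ ∫⁻ k : ℤ, ‖(k : ℝ)‖ₑ ∂m ≠ ⊤ := by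
  rw [← lt_top_iff_ne_top]
  exact ⟨fun h => h.2, fun h => ⟨Measurable.of_discrete.aestronglyMeasurable, h⟩⟩

omit [IsProbabilityMeasure α] [IsProbabilityMeasure β] in
lemma tsum_piWeight (hα : ∀ k ≤ 0, α {k} = 0) (hβ : ∀ k, 0 ≤ k → β {k} = 0) :
    ∑' y, piWeight α β y = ∫⁻ k : ℤ, ‖(k : ℝ)‖ₑ ∂α + ∫⁻ k : ℤ, ‖(k : ℝ)‖ₑ ∂β := by
  rw [← tsum_piWeight_Ici (β := β) hα, ← tsum_piWeight_Iic (α := α) hβ, ← ENNReal.tsum_add]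
  refine tsum_congr fun y => ?_
  rcases le_or_gt y 0 with hy | hy
  · have : ¬ (1 ≤ y) := by omega
    simp [Set.indicator, hy, this]
  · have h1 : ¬ (y ≤ 0) := by omega
    have h2 : 1 ≤ y := by omega
    simp [Set.indicator, h1, h2]

/-- `B` is surely hit from `w` if it is surely hit from every possible next state outside `B`. -/
lemma hitOp_one_of_forall {ι : Type*} {a : ι → ι → ℝ≥0∞} (ha : ∀ x, ∑' z, a x z = 1) {B : Set ι}
    {w : ι} (h : ∀ z ∉ B, a w z ≠ 0 → hitOp a B 1 z = 1) : hitOp a B 1 w = 1 := by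
  have h1 : op (taboo a B) (hitOp a B 1) w = op (taboo a B) 1 w := by
    refine tsum_congr fun z => ?_
    by_cases hz : z ∈ B
    · simp [taboo, hz]
    · by_cases h0 : a w z = 0
      · simp [taboo, hz, h0]
      · rw [h z hz h0, Pi.one_apply]
  rw [hitOp_eq, h1, add_comm, ← Pi.add_apply, ← op_eq_taboo_add, op_one ha, Pi.one_apply]

/-- The chain climbs on `(-∞, 0]`, so that it surely reaches `[1, ∞)`. -/
lemma hitOp_Ici_one (hα : ∀ k ≤ 0, α {k} = 0) (w : ℤ) :
    hitOp (transMat (oscWalk α β)) (Set.Ici 1) 1 w = 1 := by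
  have ha := transMat_tsum (oscWalk α β)
  have key : ∀ n : ℕ, ∀ w : ℤ, w ≤ 0 → -w < n →
      hitOp (transMat (oscWalk α β)) (Set.Ici 1) 1 w = 1 := by
    intro n
    induction n with
    | zero => intro w h1 h2; push_cast at h2; omega
    | succ n ih =>
      intro w h1 h2
      refine hitOp_one_of_forall ha fun z hz h0 => ?_
      rw [transMat_walkKernel, oscStep, if_pos h1] at h0
      have h3 : 0 < z - w := not_le.1 fun h => h0 (hα _ h)
      simp at hz
      exact ih z (by omega) (by push_cast at h2; omega)
  refine hitOp_one_of_forall ha fun z hz _ => ?_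
  simp at hz
  exact key ((-z).toNat + 1) z (by omega) (by omega)

/-- The chain descends on `[1, ∞)`, so that it surely reaches `(-∞, 0]`. -/
lemma hitOp_Iic_zero (hβ : ∀ k, 0 ≤ k → β {k} = 0) (w : ℤ) :
    hitOp (transMat (oscWalk α β)) (Set.Iic 0) 1 w = 1 := by
  have ha := transMat_tsum (oscWalk α β)
  have key : ∀ n : ℕ, ∀ w : ℤ, 0 < w → w ≤ n →
      hitOp (transMat (oscWalk α β)) (Set.Iic 0) 1 w = 1 := by
    intro n
    induction n with
    | zero => intro w h1 h2; push_cast at h2; omega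
    | succ n ih =>
      intro w h1 h2
      refine hitOp_one_of_forall ha fun z hz h0 => ?_
      rw [transMat_walkKernel, oscStep, if_neg (by omega)] at h0
      have h3 : z - w < 0 := not_le.1 fun h => h0 (hβ _ h)
      simp at hz
      exact ih z (by omega) (by push_cast at h2; omega)
  refine hitOp_one_of_forall ha fun z hz _ => ?_
  simp at hz
  exact key z.toNat z (by omega) (by omega)

lemma piWeight_le_one (y : ℤ) : piWeight α β y ≤ 1 := by
  unfold piWeight; split_ifs <;> exact prob_le_one

lemma IsIrreducible.exists_pow_ne_zero {p : Kernel ℤ ℤ} [IsMarkovKernel p] (h : IsIrreducible p)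
    (x y : ℤ) : ∃ n, (op (transMat p) ^ n) (Pi.single y 1) x ≠ 0 := by
  obtain ⟨n, hn⟩ := h x y
  exact ⟨n, by rw [← pathLaw_eval]; exact hn.ne'⟩

lemma piWeight_ne_zero (hα : ∀ k ≤ 0, α {k} = 0) (hβ : ∀ k, 0 ≤ k → β {k} = 0)
    (hirr : IsIrreducible (oscWalk α β)) (y : ℤ) : piWeight α β y ≠ 0 := by
  obtain ⟨n, hn⟩ := hirr.exists_pow_ne_zero 0 y
  have h0 : piWeight α β 0 = 1 := by
    have h1 : β (Set.Iic (-1)) = _ := measure_eq_tsum_ite β (fun j => j ≤ -1)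
    rw [piWeight, if_neg (by omega), zero_sub, h1, ← tsum_singleton β]
    refine tsum_congr fun k => ?_
    split_ifs with hk
    · rfl
    · exact (hβ k (by omega)).symm
  have h2 := tsum_mul_op_pow (piWeight_invariant hα hβ) (Pi.single y 1) n
  rw [tsum_eq_single (f := fun z => piWeight α β z * (Pi.single y 1 : ℤ → ℝ≥0∞) z) y
    (fun z hz => by simp [hz]), Pi.single_eq_same, mul_one] at h2
  rw [← h2]
  refine ne_of_gt (lt_of_lt_of_le (pos_iff_ne_zero.2 hn) ?_)
  refine le_trans (le_of_eq ?_) (ENNReal.le_tsum 0)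
  rw [h0, one_mul]

/-- Recurrence of the chain as soon as one of the two laws has a finite mean. -/
lemma iInf_survive_eq_zero (hα : ∀ k ≤ 0, α {k} = 0) (hβ : ∀ k, 0 ≤ k → β {k} = 0)
    (hirr : IsIrreducible (oscWalk α β))
    (h : Integrable (fun k : ℤ => (k : ℝ)) α ∨ Integrable (fun k : ℤ => (k : ℝ)) β) (x : ℤ) :
    ⨅ n, (op (taboo (transMat (oscWalk α β)) {x}) ^ n) 1 x = 0 := by
  have ha := transMat_tsum (oscWalk α β)
  have hπ := piWeight_invariant hα hβ
  obtain ⟨y, hy⟩ : ∃ y, green (transMat (oscWalk α β)) y y = ⊤ := by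
    rcases h with h | h
    · refine ⟨1, green_eq_top_of_finite_recurrent_set ha hπ (B := Set.Ici 1) ?_
        (fun z _ => hitOp_Ici_one hα z) (by simp) (piWeight_ne_zero hα hβ hirr 1)⟩
      rw [tsum_piWeight_Ici hα]; exact (integrable_iff α).1 h
    · refine ⟨0, green_eq_top_of_finite_recurrent_set ha hπ (B := Set.Iic 0) ?_
        (fun z _ => hitOp_Iic_zero hβ z) (by simp) (piWeight_ne_zero hα hβ hirr 0)⟩
      rw [tsum_piWeight_Iic hβ]; exact (integrable_iff β).1 h
  by_contra h0
  obtain ⟨m, hm⟩ := hirr.exists_pow_ne_zero x y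
  obtain ⟨k, hk⟩ := hirr.exists_pow_ne_zero y x
  exact (green_lt_top_of_communicate hm hk (green_lt_top_of_iInf_survive_ne_zero ha h0)).ne hy

/-- At a recurrent state, `E_x(T_x)` is finite if and only if the invariant measure is. -/
lemma tsum_survive_lt_top_iff (hα : ∀ k ≤ 0, α {k} = 0) (hβ : ∀ k, 0 ≤ k → β {k} = 0)
    (hirr : IsIrreducible (oscWalk α β)) {x : ℤ}
    (hrec : ⨅ n, (op (taboo (transMat (oscWalk α β)) {x}) ^ n) 1 x = 0) :
    ∑' n, (op (taboo (transMat (oscWalk α β)) {x}) ^ n) 1 x < ⊤ ↔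
      Integrable (fun k : ℤ => (k : ℝ)) α ∧ Integrable (fun k : ℤ => (k : ℝ)) β := by
  have hx : piWeight α β x ≠ ⊤ := ne_top_of_le_ne_top ENNReal.one_ne_top (piWeight_le_one x)
  have h := tsum_eq_mul_tsum_survive (transMat_tsum (oscWalk α β)) (piWeight_invariant hα hβ) hx
    (fun z => hirr.exists_pow_ne_zero z x) hrec
  rw [tsum_piWeight hα hβ] at h
  rw [integrable_iff, integrable_iff, ← ENNReal.add_ne_top, h, lt_top_iff_ne_top]
  refine ⟨fun h1 => ENNReal.mul_ne_top hx h1, fun h1 h2 => h1 ?_⟩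
  rw [h2, ENNReal.mul_top (piWeight_ne_zero hα hβ hirr x)]

lemma isPositiveRecurrent_iff (hα : ∀ k ≤ 0, α {k} = 0) (hβ : ∀ k, 0 ≤ k → β {k} = 0)
    (hirr : IsIrreducible (oscWalk α β)) :
    IsPositiveRecurrent (oscWalk α β) ↔
      Integrable (fun k : ℤ => (k : ℝ)) α ∧ Integrable (fun k : ℤ => (k : ℝ)) β := by
  constructor
  · intro h
    have h0 := h 0
    rw [pathLaw_passageTime_eq_one_iff, lintegral_passageTime] at h0
    exact (tsum_survive_lt_top_iff hα hβ hirr h0.1).1 h0.2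
  · intro h x
    have hrec := iInf_survive_eq_zero hα hβ hirr (Or.inl h.1) x
    rw [pathLaw_passageTime_eq_one_iff, lintegral_passageTime]
    exact ⟨hrec, (tsum_survive_lt_top_iff hα hβ hirr hrec).2 h⟩

lemma isNullRecurrent_of_integrable_xor (hα : ∀ k ≤ 0, α {k} = 0) (hβ : ∀ k, 0 ≤ k → β {k} = 0)
    (hirr : IsIrreducible (oscWalk α β))
    (h : Integrable (fun k : ℤ => (k : ℝ)) α ∨ Integrable (fun k : ℤ => (k : ℝ)) β)
    (h' : ¬ (Integrable (fun k : ℤ => (k : ℝ)) α ∧ Integrable (fun k : ℤ => (k : ℝ)) β)) :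
    IsNullRecurrent (oscWalk α β) := fun x => by
  have hrec := iInf_survive_eq_zero hα hβ hirr h x
  rw [pathLaw_passageTime_eq_one_iff, lintegral_passageTime]
  refine ⟨hrec, not_lt_top_iff.1 fun hlt => h' ((tsum_survive_lt_top_iff hα hβ hirr hrec).1 hlt)⟩

end Osc

/-! ### Translates of homogeneous walks -/

section Embedding

variable {σ : ℤ → Measure ℤ} {μ : Measure ℤ} {B : Set ℤ} {z : ℤ}

/-- As long as it stays in a region where the jumps have law `μ`, a walk is a translate of the
homogeneous walk with step law `μ`. -/
lemma op_taboo_translate (hσ : ∀ w ∉ B, σ (z + w) = μ) (n : ℕ) (f : ℤ → ℝ≥0∞) {w : ℤ}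
    (hw : w ∉ B) :
    (op (taboo (transMat (walkKernel σ)) {u | u - z ∈ B}) ^ n) f (z + w) =
      (op (taboo (transMat (homWalk μ)) B) ^ n) (fun v => f (z + v)) w := by
  induction n generalizing w with
  | zero => simp
  | succ n ih =>
    rw [op_pow_succ_apply, op_pow_succ_apply, ← op_taboo_congr (fun v hv => ih hv),
      op_taboo_eq, op_taboo_eq, op_walkKernel, op_walkKernel, hσ w hw]
    refine lintegral_congr fun k => ?_
    have hmem : z + (w + k) ∈ {u | u - z ∈ B} ↔ w + k ∈ B := by
      change z + (w + k) - z ∈ B ↔ _; rw [add_sub_cancel_left]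
    rw [add_assoc]
    by_cases h : w + k ∈ B
    · rw [Set.indicator_of_notMem (Set.notMem_compl_iff.2 (hmem.2 h)),
        Set.indicator_of_notMem (Set.notMem_compl_iff.2 h)]
    · rw [Set.indicator_of_mem (Set.mem_compl (mt hmem.1 h)),
        Set.indicator_of_mem (Set.mem_compl h)]

variable [IsProbabilityMeasure μ]

/-- The displacement of the walk started at `z` enters `B` at a point of law `entranceLaw μ B`. -/
lemma hitOp_translate (h0 : (0 : ℤ) ∉ B) (hσ : ∀ w ∉ B, σ (z + w) = μ) (f : ℤ → ℝ≥0∞) :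
    hitOp (transMat (walkKernel σ)) {u | u - z ∈ B} f z =
      ∫⁻ k, f (z + k) ∂(entranceLaw μ B) := by
  rw [lintegral_entranceLaw μ h0]
  refine tsum_congr fun n => ?_
  have h1 := op_taboo_translate hσ n
    (op (taboo (transMat (walkKernel σ)) {u | u - z ∈ B}ᶜ) f) h0
  rw [add_zero] at h1
  rw [h1, op_pow_eq_tsum, op_pow_eq_tsum]
  refine tsum_congr fun w => ?_
  by_cases hw : w ∈ B
  · cases n with
    | zero =>
      have : w ≠ 0 := fun h => h0 (h ▸ hw)
      simp [this.symm]
    | succ n => simp [op_pow_succ_apply', op_taboo_single hw]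
  · congr 1
    rw [op_taboo_eq, op_taboo_eq, op_walkKernel, op_walkKernel, hσ w hw]
    refine lintegral_congr fun k => ?_
    have hmem : z + (w + k) ∈ {u | u - z ∈ B} ↔ w + k ∈ B := by
      change z + (w + k) - z ∈ B ↔ _; rw [add_sub_cancel_left]
    rw [add_assoc, compl_compl, compl_compl]
    by_cases h : w + k ∈ B
    · rw [Set.indicator_of_mem (hmem.2 h), Set.indicator_of_mem h]
    · rw [Set.indicator_of_notMem (fun h' => h (hmem.1 h')), Set.indicator_of_notMem h]

/-- If the homogeneous walk surely enters `B`, then before this it visits each state a finite number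
of times in the mean. -/
lemma green_taboo_lt_top [IsProbabilityMeasure (entranceLaw μ B)] (h0 : (0 : ℤ) ∉ B) (w : ℤ) :
    green (taboo (transMat (homWalk μ)) B) w 0 < ⊤ := by
  set r := taboo (transMat (homWalk μ)) B
  have hr : ∀ x, ∑' z, r x z ≤ 1 := taboo_tsum_le fun x => (transMat_tsum (homWalk μ) x).le
  by_cases hk : ∃ k, (op r ^ k) (Pi.single w 1) 0 ≠ 0
  · obtain ⟨k, hk⟩ := hk
    set c := (op r ^ k) (Pi.single w 1) 0
    have hc : c ≠ ⊤ := ne_top_of_le_ne_top ENNReal.one_ne_top (op_pow_single_le_one hr k 0 w)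
    have h1 : ⨅ n, (op r ^ n) 1 0 = 0 := by
      have h := hitOp_one_add_iInf (B := B) (transMat_tsum (homWalk μ)) 0
      rw [← lintegral_entranceLaw μ h0] at h
      simp only [Pi.one_apply, lintegral_const, measure_univ, mul_one] at h
      exact (ENNReal.add_right_inj ENNReal.one_ne_top).1 (h.trans (add_zero 1).symm)
    obtain ⟨n, hn⟩ : ∃ n, (op r ^ n) 1 0 < c * 2⁻¹ := by
      rw [← iInf_lt_iff, h1]
      exact ENNReal.mul_pos hk (by simp)
    -- A large probability of survival from `w` would also be seen from `0`, which leads to `w`.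
    have h2 : c * (op r ^ n) 1 w ≤ c * 2⁻¹ := by
      refine (op_pow_single_mul_le _ k 0 w).trans ?_
      rw [← Module.End.mul_apply, ← pow_add]
      exact (op_pow_one_antitone hr 0 (Nat.le_add_left n k)).trans hn.le
    refine (green_le hr 0 w).trans_lt (green_lt_top_of_op_pow_one_le hr (N := n) ?_)
    exact (ENNReal.mul_le_mul_iff_right hk hc).1 h2
  · push Not at hk
    simp [green, hk]

end Embedding

/-! ### Embedding of the ladder chain in the oscillating walk -/

section Oscillating

variable {μ ν : Measure ℤ}

/-- The displacements at which the embedded chain, now at `z`, is next observed: the positive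
ones if `z ≤ 0`, the negative ones if `z ≥ 1`. -/
def crossing (z : ℤ) : Set ℤ := if z ≤ 0 then Set.Ici 1 else Set.Iic (-1)

lemma zero_notMem_crossing (z : ℤ) : (0 : ℤ) ∉ crossing z := by
  unfold crossing; split_ifs <;> simp

lemma oscStep_of_notMem_crossing {z w : ℤ} (hw : w ∉ crossing z) :
    oscStep μ ν (z + w) = oscStep μ ν z := by
  unfold crossing at hw
  unfold oscStep
  split_ifs at hw with hz
  · simp only [Set.mem_Ici, not_le] at hw
    rw [if_pos hz, if_pos (by omega)]
  · simp only [Set.mem_Iic, not_le] at hw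
    rw [if_neg hz, if_neg (by omega)]

/-- The expected number of visits of the oscillating walk to `y` before the embedded
chain is next observed, after a start at `z`. -/
def visits (μ ν : Measure ℤ) (y z : ℤ) : ℝ≥0∞ :=
  ∑' n : ℕ, (op (taboo (transMat (oscWalk μ ν)) {u | u - z ∈ crossing z}) ^ n) (Pi.single y 1) z

lemma visits_eq_zero {y z : ℤ} (h : y - z ∈ crossing z) : visits μ ν y z = 0 := by
  have hz : z ≠ y := fun h1 => zero_notMem_crossing z (by rwa [h1, sub_self, ← h1] at h)
  refine ENNReal.tsum_eq_zero.2 fun n => ?_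
  cases n with
  | zero => simp [hz]
  | succ n => rw [op_pow_succ_apply', op_taboo_single (by exact h)]; simp

variable [IsProbabilityMeasure μ] [IsProbabilityMeasure ν]

lemma entranceLaw_crossing (z : ℤ) :
    entranceLaw (oscStep μ ν z) (crossing z) = oscStep (muPlus μ) (nuMinus ν) z := by
  unfold crossing
  simp only [oscStep]
  split_ifs <;> rfl

/-- The truncated Green function of the oscillating walk is at most the sum of the visits made between
the successive positions of the embedded chain. -/
lemma sum_op_pow_oscWalk_le (y : ℤ) (N : ℕ) :
    ∑ n ∈ Finset.range N, (op (transMat (oscWalk μ ν)) ^ n) (Pi.single y 1) ≤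
      ∑ n ∈ Finset.range N,
        (op (transMat (oscWalk (muPlus μ) (nuMinus ν))) ^ n) (visits μ ν y) := by
  induction N with
  | zero => simp
  | succ N ih =>
    intro z
    have h1 := sum_op_pow_succ_le (transMat (oscWalk μ ν)) {u | u - z ∈ crossing z}
      (Pi.single y 1) N z
    rw [hitOp_translate (μ := oscStep μ ν z) (zero_notMem_crossing z)
      (fun w hw => oscStep_of_notMem_crossing hw), entranceLaw_crossing, ← op_walkKernel] at h1
    rw [Finset.sum_apply]
    refine h1.trans ?_
    rw [Finset.sum_range_succ', add_comm]
    simp only [op_pow_succ_apply, pow_zero, Module.End.one_apply, ← map_sum]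
    exact add_le_add_left (op_mono ih z) _

variable [IsProbabilityMeasure (muPlus μ)] [IsProbabilityMeasure (nuMinus ν)]

lemma visits_lt_top (y z : ℤ) : visits μ ν y z < ⊤ := by
  have : IsProbabilityMeasure (entranceLaw (oscStep μ ν z) (crossing z)) := by
    rw [entranceLaw_crossing]; infer_instance
  refine lt_of_eq_of_lt (tsum_congr fun n => ?_)
    (green_taboo_lt_top (μ := oscStep μ ν z) (zero_notMem_crossing z) (y - z))
  have h := op_taboo_translate (σ := oscStep μ ν) (z := z)
    (fun w hw => oscStep_of_notMem_crossing hw) n (Pi.single y 1) (zero_notMem_crossing z)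
  rw [add_zero] at h
  rw [h]
  refine congrFun (congrArg _ ?_) 0
  ext v
  by_cases hv : v = y - z
  · subst hv; simp
  · have : z + v ≠ y := by omega
    simp [hv, this]

/-- Transience passes from the embedded chain to the oscillating walk. -/
lemma green_oscWalk_lt_top
    (h : ∀ z, green (transMat (oscWalk (muPlus μ) (nuMinus ν))) z z < ⊤) (x y : ℤ) :
    green (transMat (oscWalk μ ν)) y x < ⊤ := by
  set Z := transMat (oscWalk (muPlus μ) (nuMinus ν))
  have hZ : ∀ x, ∑' y, Z x y ≤ 1 := fun x => (transMat_tsum _ x).le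
  have h1 : green (transMat (oscWalk μ ν)) y x ≤ ∑' n, (op Z ^ n) (visits μ ν y) x := by
    refine ENNReal.tsum_le_of_sum_range_le fun N => ?_
    have := sum_op_pow_oscWalk_le (μ := μ) (ν := ν) y N x
    rw [Finset.sum_apply, Finset.sum_apply] at this
    exact this.trans (ENNReal.sum_le_tsum _)
  have h2 : ∑' n, (op Z ^ n) (visits μ ν y) x = ∑' z, green Z z x * visits μ ν y z := by
    simp_rw [op_pow_eq_tsum (visits μ ν y), green, ← ENNReal.tsum_mul_right]
    exact ENNReal.tsum_comm
  -- Only finitely many `z` contribute: those between `y` and the boundary on the side of `y`.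
  rw [h2, tsum_eq_sum (s := Finset.Icc (-|y|) |y|)] at h1
  · refine h1.trans_lt (ENNReal.sum_lt_top.2 fun z _ => ENNReal.mul_lt_top ?_ (visits_lt_top y z))
    exact (green_le hZ x z).trans_lt (h z)
  · intro z hz
    rw [visits_eq_zero, mul_zero]
    rw [Finset.mem_Icc, not_and_or, not_le, not_le] at hz
    have := neg_abs_le y
    have := le_abs_self y
    have := abs_nonneg y
    unfold crossing
    split_ifs
    · simp only [Set.mem_Ici]; omega
    · simp only [Set.mem_Iic]; omega

end Oscillating

/-! ### Transience by Fourier inversion -/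

section Fourier

lemma integrable_exp (m : Measure ℤ) [IsFiniteMeasure m] (t : ℝ) :
    Integrable (fun k : ℤ => Complex.exp (Complex.I * t * k)) m := by
  refine Integrable.of_bound Measurable.of_discrete.aestronglyMeasurable 1 (ae_of_all _ fun k => ?_)
  rw [show Complex.I * t * k = ((t * k : ℝ) : ℂ) * Complex.I by push_cast; ring,
    Complex.norm_exp_ofReal_mul_I]

lemma charFn_conv (m m' : Measure ℤ) [IsProbabilityMeasure m] [IsProbabilityMeasure m'] (t : ℝ) :
    charFn (m ∗ m') t = charFn m t * charFn m' t := by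
  unfold charFn
  rw [integral_conv (integrable_exp _ t), ← integral_mul_const]
  refine integral_congr_ae (ae_of_all _ fun k => ?_)
  simp only
  rw [← integral_const_mul]
  refine integral_congr_ae (ae_of_all _ fun l => ?_)
  simp only
  rw [← Complex.exp_add]
  push_cast
  ring_nf

/-- Fourier inversion at `0`. -/
lemma integral_charFn (m : Measure ℤ) [IsProbabilityMeasure m] :
    ∫ t in Set.Ioo 0 (2 * Real.pi), charFn m t = 2 * Real.pi * (m {0}).toReal := by
  unfold charFn
  rw [integral_integral_swap]
  · have h1 : ∀ k : ℤ, ∫ t in Set.Ioo 0 (2 * Real.pi), Complex.exp (Complex.I * (t : ℝ) * k) =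
        ({0} : Set ℤ).indicator (fun _ => (2 * Real.pi : ℂ)) k := by
      intro k
      rw [← integral_Ioc_eq_integral_Ioo, ← intervalIntegral.integral_of_le (by positivity)]
      by_cases hk : k = 0
      · subst hk; simp
      · have hc : Complex.I * k ≠ 0 := mul_ne_zero Complex.I_ne_zero (by exact_mod_cast hk)
        have h2 : ∀ t : ℝ, Complex.exp (Complex.I * t * k) = Complex.exp (Complex.I * k * t) :=
          fun t => by ring_nf
        simp_rw [h2]
        rw [integral_exp_mul_complex hc]
        have h3 : Complex.exp (Complex.I * k * ((2 * Real.pi : ℝ) : ℂ)) = 1 := by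
          rw [Complex.exp_eq_one_iff]
          exact ⟨k, by push_cast; ring⟩
        rw [h3]
        simp [hk]
    simp_rw [h1]
    rw [integral_indicator_const _ (MeasurableSet.singleton 0)]
    rw [Measure.real, Complex.real_smul]
    ring
  · refine Integrable.of_bound (Measurable.aestronglyMeasurable ?_) 1 (ae_of_all _ fun q => ?_)
    · have : Measurable fun k : ℤ => (k : ℂ) := Measurable.of_discrete
      simp only [Function.uncurry_def]
      fun_prop
    · simp only [Function.uncurry_def]
      rw [show Complex.I * (q.1 : ℝ) * (q.2 : ℤ) = ((q.1 * q.2 : ℝ) : ℂ) * Complex.I by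
        push_cast; ring, Complex.norm_exp_ofReal_mul_I]

lemma measurable_charFn (m : Measure ℤ) [IsProbabilityMeasure m] : Measurable (charFn m) := by
  refine StronglyMeasurable.measurable ?_
  refine StronglyMeasurable.integral_prod_right (f := fun (t : ℝ) (k : ℤ) =>
    Complex.exp (Complex.I * t * k)) (Measurable.stronglyMeasurable ?_)
  have : Measurable fun k : ℤ => (k : ℂ) := Measurable.of_discrete
  simp only [Function.uncurry_def]
  fun_prop

lemma norm_charFn_le_one (m : Measure ℤ) [IsProbabilityMeasure m] (t : ℝ) : ‖charFn m t‖ ≤ 1 := by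
  refine (norm_integral_le_of_norm_le_const (C := 1) (ae_of_all _ fun k => ?_)).trans (by simp)
  rw [show Complex.I * t * k = ((t * k : ℝ) : ℂ) * Complex.I by push_cast; ring,
    Complex.norm_exp_ofReal_mul_I]

/-- Partial sums of a geometric series of ratio `c` in the closed unit disc are at most
`2 / |1 - c|`. -/
lemma enorm_geom_sum_le {c : ℂ} (hc : ‖c‖ ≤ 1) (N : ℕ) :
    ‖∑ i ∈ Finset.range N, c ^ i‖ₑ ≤ 2 * ‖1 - c‖ₑ⁻¹ := by
  by_cases h : c = 1
  · simp [h]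
  · have h1 : 1 - c ≠ 0 := sub_ne_zero.2 (Ne.symm h)
    rw [← div_eq_mul_inv, ENNReal.le_div_iff_mul_le (by simp [h1]) (by simp), ← enorm_mul,
      mul_comm, mul_neg_geom_sum, ← ofReal_norm, ← ENNReal.ofReal_ofNat]
    refine ENNReal.ofReal_le_ofReal ?_
    calc ‖1 - c ^ N‖ ≤ ‖(1 : ℂ)‖ + ‖c ^ N‖ := norm_sub_le _ _
      _ ≤ 1 + 1 := by
        rw [norm_one, norm_pow]
        gcongr
        exact pow_le_one₀ (norm_nonneg _) hc
      _ = 2 := by norm_num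

lemma op_homWalk_comm (α β : Measure ℤ) [SFinite α] [SFinite β] :
    op (transMat (homWalk β)) * op (transMat (homWalk α)) =
      op (transMat (homWalk α)) * op (transMat (homWalk β)) := by
  ext f x
  simp only [Module.End.mul_apply, op_walkKernel]
  rw [lintegral_lintegral_swap Measurable.of_discrete.aemeasurable]
  simp_rw [add_right_comm]

/-- A trajectory of the oscillating walk from `x` to `y` in `n` steps uses `i` steps of law `α` and
`j` steps of law `β` with `i + j = n`, and its contribution is accounted for by the sum of that many
independent steps. -/
lemma op_oscWalk_pow_le (α β : Measure ℤ) [SFinite α] [SFinite β] (f : ℤ → ℝ≥0∞)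
    (n : ℕ) : (op (transMat (oscWalk α β)) ^ n) f ≤ ∑ q ∈ Finset.HasAntidiagonal.antidiagonal n,
      (op (transMat (homWalk α)) ^ q.1 * op (transMat (homWalk β)) ^ q.2) f := by
  induction n with
  | zero => simp
  | succ n ih =>
    set A := op (transMat (homWalk α))
    set B := op (transMat (homWalk β))
    have hcomm : ∀ i, B * A ^ i = A ^ i * B := fun i =>
      ((show Commute B A from op_homWalk_comm α β).pow_right i).eq
    intro x
    rw [op_pow_succ_apply]
    refine (op_mono ih x).trans ?_
    rw [op_walkKernel, oscStep]
    split_ifs with hx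
    · rw [← op_walkKernel (fun _ => α), map_sum, Finset.Nat.sum_antidiagonal_succ, Pi.add_apply]
      refine le_trans (le_of_eq ?_) le_add_self
      refine congrFun (Finset.sum_congr rfl fun q _ => ?_) x
      rw [← Module.End.mul_apply, pow_succ', mul_assoc]
    · rw [← op_walkKernel (fun _ => β), map_sum, Finset.Nat.sum_antidiagonal_succ', Pi.add_apply]
      refine le_trans (le_of_eq ?_) le_add_self
      refine congrFun (Finset.sum_congr rfl fun q _ => ?_) x
      rw [← Module.End.mul_apply, ← mul_assoc, hcomm, mul_assoc, pow_succ']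

variable (α β : Measure ℤ) [IsProbabilityMeasure α] [IsProbabilityMeasure β]

/-- The law of the sum of `i` steps of law `α` and `j` steps of law `β`, all independent. -/
lemma exists_law_op_pow (i j : ℕ) : ∃ m : Measure ℤ, IsProbabilityMeasure m ∧
    (∀ f x, (op (transMat (homWalk α)) ^ i * op (transMat (homWalk β)) ^ j) f x =
      ∫⁻ k, f (x + k) ∂m) ∧ ∀ t, charFn m t = charFn α t ^ i * charFn β t ^ j := by
  have step : ∀ (γ m : Measure ℤ) [IsProbabilityMeasure γ] [IsProbabilityMeasure m]
      (T : Module.End ℝ≥0∞ (ℤ → ℝ≥0∞)), (∀ f x, T f x = ∫⁻ k, f (x + k) ∂m) →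
      ∀ f x, (op (transMat (homWalk γ)) * T) f x = ∫⁻ k, f (x + k) ∂(γ ∗ m) := by
    intro γ m _ _ T hT f x
    rw [Module.End.mul_apply, op_walkKernel, Measure.lintegral_conv Measurable.of_discrete]
    simp_rw [hT, add_assoc]
  have hβ : ∃ m : Measure ℤ, IsProbabilityMeasure m ∧
      (∀ f x, (op (transMat (homWalk β)) ^ j) f x = ∫⁻ k, f (x + k) ∂m) ∧
        ∀ t, charFn m t = charFn β t ^ j := by
    induction j with
    | zero => exact ⟨Measure.dirac 0, inferInstance, by simp, by simp [charFn]⟩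
    | succ j ih =>
      obtain ⟨m, hm, h1, h2⟩ := ih
      refine ⟨β ∗ m, inferInstance, fun f x => ?_, fun t => ?_⟩
      · rw [pow_succ', step β m _ h1]
      · rw [charFn_conv, h2, pow_succ']
  induction i with
  | zero => simpa using hβ
  | succ i ih =>
    obtain ⟨m, hm, h1, h2⟩ := ih
    refine ⟨α ∗ m, inferInstance, fun f x => ?_, fun t => ?_⟩
    · rw [pow_succ', mul_assoc, step α m _ h1]
    · rw [charFn_conv, h2, pow_succ', mul_assoc]

/-- Transience criterion: the Green function of the oscillating walk at `0` is at most
`∑ i j, P(X_1 + ⋯ + X_i + Y_1 + ⋯ + Y_j = 0)` for independent `X_k` of law `α` and `Y_k` of law `β`,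
which Fourier inversion bounds by a multiple of the integral of `|1 - φ|⁻¹ |1 - ψ|⁻¹`, with `φ` and
`ψ` the characteristic functions of `α` and `β`. -/
lemma green_oscWalk_zero_lt_top
    (hα : ∫⁻ t in Set.Ioo (0 : ℝ) (2 * Real.pi), (‖1 - charFn α t‖ₑ ^ 2)⁻¹ < ⊤)
    (hβ : ∫⁻ t in Set.Ioo (0 : ℝ) (2 * Real.pi), (‖1 - charFn β t‖ₑ ^ 2)⁻¹ < ⊤) :
    green (transMat (oscWalk α β)) 0 0 < ⊤ := by
  set F : ℕ → ℕ → ℝ≥0∞ := fun i j =>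
    (op (transMat (homWalk α)) ^ i * op (transMat (homWalk β)) ^ j) (Pi.single 0 1) 0 with hF
  set C : ℝ≥0∞ := ∫⁻ t in Set.Ioo (0 : ℝ) (2 * Real.pi),
    4 * ((‖1 - charFn α t‖ₑ ^ 2)⁻¹ + (‖1 - charFn β t‖ₑ ^ 2)⁻¹) with hC
  have hCtop : C < ⊤ := by
    have hm : Measurable fun t => (‖1 - charFn α t‖ₑ ^ 2)⁻¹ :=
      (((measurable_const.sub (measurable_charFn α)).enorm).pow_const 2).inv
    rw [hC, lintegral_const_mul' _ _ (by simp), lintegral_add_left hm]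
    exact ENNReal.mul_lt_top (by simp) (ENNReal.add_lt_top.2 ⟨hα, hβ⟩)
  have h1 : green (transMat (oscWalk α β)) 0 0 ≤ ∑' i, ∑' j, F i j := by
    rw [← ENNReal.tsum_prod, ← Finset.HasAntidiagonal.sigmaAntidiagonalEquivProd.tsum_eq,
      ENNReal.tsum_sigma']
    refine ENNReal.tsum_le_tsum fun n => ?_
    refine (op_oscWalk_pow_le α β (Pi.single 0 1) n 0).trans (le_of_eq ?_)
    rw [Finset.sum_apply, tsum_fintype, ← Finset.sum_coe_sort]
    rfl
  have h2 : ∀ N M, ∑ i ∈ Finset.range N, ∑ j ∈ Finset.range M, F i j ≤ C := by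
    intro N M
    choose m hm hop hchar using exists_law_op_pow α β
    have e1 : ∀ i j, F i j = m i j {0} := fun i j => by
      simp only [hF]
      rw [hop, lintegral_countable', tsum_eq_single 0]
      · simp
      · intro k hk; simp [hk]
    have e2 : ((2 * Real.pi : ℝ) : ℂ) *
        (∑ i ∈ Finset.range N, ∑ j ∈ Finset.range M, (m i j {0}).toReal : ℝ) =
        ∫ t in Set.Ioo 0 (2 * Real.pi), (∑ i ∈ Finset.range N, charFn α t ^ i) *
          ∑ j ∈ Finset.range M, charFn β t ^ j := by
      have hint : ∀ i j, Integrable (fun t => charFn (m i j) t)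
          (volume.restrict (Set.Ioo 0 (2 * Real.pi))) := fun i j =>
        Integrable.of_bound (measurable_charFn _).aestronglyMeasurable 1
          (ae_of_all _ fun t => norm_charFn_le_one _ t)
      simp_rw [Finset.sum_mul_sum, ← hchar]
      rw [integral_finsetSum _ fun i _ => integrable_finsetSum _ fun j _ => hint i j]
      push_cast
      rw [Finset.mul_sum]
      refine Finset.sum_congr rfl fun i _ => ?_
      rw [integral_finsetSum _ fun j _ => hint i j, Finset.mul_sum]
      refine Finset.sum_congr rfl fun j _ => ?_
      rw [integral_charFn]
    set s : ℝ := ∑ i ∈ Finset.range N, ∑ j ∈ Finset.range M, (m i j {0}).toReal with hs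
    have hs0 : 0 ≤ s := Finset.sum_nonneg fun i _ => Finset.sum_nonneg fun j _ =>
      ENNReal.toReal_nonneg
    have e3 : ∑ i ∈ Finset.range N, ∑ j ∈ Finset.range M, F i j = ENNReal.ofReal s := by
      rw [hs, ENNReal.ofReal_sum_of_nonneg fun i _ => Finset.sum_nonneg fun j _ =>
        ENNReal.toReal_nonneg]
      refine Finset.sum_congr rfl fun i _ => ?_
      rw [ENNReal.ofReal_sum_of_nonneg fun j _ => ENNReal.toReal_nonneg]
      refine Finset.sum_congr rfl fun j _ => ?_
      rw [ENNReal.ofReal_toReal (measure_ne_top _ _), e1]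
    calc ∑ i ∈ Finset.range N, ∑ j ∈ Finset.range M, F i j
        ≤ ENNReal.ofReal ‖((2 * Real.pi : ℝ) : ℂ) * (s : ℂ)‖ := by
          rw [e3]
          refine ENNReal.ofReal_le_ofReal ?_
          rw [← Complex.ofReal_mul, Complex.norm_real, Real.norm_of_nonneg (by positivity)]
          nlinarith [Real.pi_gt_three]
      _ = ‖∫ t in Set.Ioo 0 (2 * Real.pi), (∑ i ∈ Finset.range N, charFn α t ^ i) *
          ∑ j ∈ Finset.range M, charFn β t ^ j‖ₑ := by rw [e2, ofReal_norm]
      _ ≤ _ := enorm_integral_le_lintegral_enorm _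
      _ ≤ C := by
        refine lintegral_mono fun t => ?_
        rw [enorm_mul]
        refine (mul_le_mul' (enorm_geom_sum_le (norm_charFn_le_one α t) N)
          (enorm_geom_sum_le (norm_charFn_le_one β t) M)).trans ?_
        rw [ENNReal.inv_pow, ENNReal.inv_pow]
        generalize ‖1 - charFn α t‖ₑ⁻¹ = u
        generalize ‖1 - charFn β t‖ₑ⁻¹ = v
        have huv : u * v ≤ u ^ 2 + v ^ 2 := by
          rcases le_total u v with h | h
          · exact (mul_le_mul_left h v).trans (by rw [← sq]; exact le_add_self)
          · exact (mul_le_mul_right h u).trans (by rw [← sq]; exact le_self_add)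
        calc 2 * u * (2 * v) = 4 * (u * v) := by ring
          _ ≤ 4 * (u ^ 2 + v ^ 2) := by gcongr
  refine lt_of_le_of_lt (h1.trans ?_) hCtop
  refine ENNReal.tsum_le_of_sum_range_le fun N => ?_
  rw [← Summable.tsum_finsetSum fun i _ => ENNReal.summable]
  refine ENNReal.tsum_le_of_sum_range_le fun M => ?_
  rw [Finset.sum_comm]
  exact h2 N M

end Fourier

end OscWalk

end

theorem mainTheorem7 (μ ν : Measure ℤ) [IsProbabilityMeasure μ] [IsProbabilityMeasure ν]
    [IsProbabilityMeasure (OscWalk.muPlus μ)] [IsProbabilityMeasure (OscWalk.nuMinus ν)]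
    (hirr : OscWalk.IsIrreducible (OscWalk.oscWalk (OscWalk.muPlus μ) (OscWalk.nuMinus ν))) :
    -- (i) invariant measure and characterization of positive recurrence
    (Kernel.Invariant (OscWalk.oscWalk (OscWalk.muPlus μ) (OscWalk.nuMinus ν))
        (OscWalk.piMeasure (OscWalk.muPlus μ) (OscWalk.nuMinus ν)) ∧
      (OscWalk.IsPositiveRecurrent (OscWalk.oscWalk (OscWalk.muPlus μ) (OscWalk.nuMinus ν)) ↔
        Integrable (fun k : ℤ => (k : ℝ)) (OscWalk.muPlus μ) ∧
        Integrable (fun k : ℤ => (k : ℝ)) (OscWalk.nuMinus ν))) ∧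
    -- (ii) exactly one finite mean
    (((Integrable (fun k : ℤ => (k : ℝ)) (OscWalk.muPlus μ) ∧
          ¬ Integrable (fun k : ℤ => (k : ℝ)) (OscWalk.nuMinus ν)) ∨
        (¬ Integrable (fun k : ℤ => (k : ℝ)) (OscWalk.muPlus μ) ∧
          Integrable (fun k : ℤ => (k : ℝ)) (OscWalk.nuMinus ν))) →
      OscWalk.IsNullRecurrent (OscWalk.oscWalk (OscWalk.muPlus μ) (OscWalk.nuMinus ν))) ∧
    -- (iii) transience of the concentrated chain and of the oscillating walk itself
    ((∫⁻ t in Set.Ioo (0 : ℝ) (2 * Real.pi),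
          (‖1 - OscWalk.charFn (OscWalk.muPlus μ) t‖ₑ ^ 2)⁻¹) < ⊤ →
      (∫⁻ t in Set.Ioo (0 : ℝ) (2 * Real.pi),
          (‖1 - OscWalk.charFn (OscWalk.nuMinus ν) t‖ₑ ^ 2)⁻¹) < ⊤ →
      OscWalk.IsTransient (OscWalk.oscWalk (OscWalk.muPlus μ) (OscWalk.nuMinus ν)) ∧
      OscWalk.IsTransient (OscWalk.oscWalk μ ν)) := by
  have hα : ∀ k ≤ 0, OscWalk.muPlus μ {k} = 0 := fun k hk =>
    OscWalk.entranceLaw_singleton_of_notMem μ (by simp only [Set.mem_Ici]; omega)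
  have hβ : ∀ k, 0 ≤ k → OscWalk.nuMinus ν {k} = 0 := fun k hk =>
    OscWalk.entranceLaw_singleton_of_notMem ν (by simp only [Set.mem_Iic]; omega)
  refine ⟨⟨OscWalk.piMeasure_invariant hα hβ, OscWalk.isPositiveRecurrent_iff hα hβ hirr⟩, ?_, ?_⟩
  · rintro (⟨h1, h2⟩ | ⟨h1, h2⟩)
    · exact OscWalk.isNullRecurrent_of_integrable_xor hα hβ hirr (Or.inl h1) fun h => h2 h.2
    · exact OscWalk.isNullRecurrent_of_integrable_xor hα hβ hirr (Or.inr h2) fun h => h1 h.1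
  · intro h1 h2
    have h0 := OscWalk.green_oscWalk_zero_lt_top (OscWalk.muPlus μ) (OscWalk.nuMinus ν) h1 h2
    have hZ : ∀ z, OscWalk.green (OscWalk.transMat
        (OscWalk.oscWalk (OscWalk.muPlus μ) (OscWalk.nuMinus ν))) z z < ⊤ := fun z => by
      obtain ⟨m, hm⟩ := hirr.exists_pow_ne_zero 0 z
      obtain ⟨k, hk⟩ := hirr.exists_pow_ne_zero z 0
      exact OscWalk.green_lt_top_of_communicate hm hk h0
    refine ⟨fun x => ?_, fun x => ?_⟩
    · rw [OscWalk.pathLaw_passageTime_lt_one_iff]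
      exact OscWalk.iInf_survive_ne_zero_of_green_lt_top (OscWalk.transMat_tsum _) (hZ x)
    · rw [OscWalk.pathLaw_passageTime_lt_one_iff]
      exact OscWalk.iInf_survive_ne_zero_of_green_lt_top (OscWalk.transMat_tsum _)
        (OscWalk.green_oscWalk_lt_top hZ x x)
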